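/- **Lemma (Root pseudometric and Busemann functions).** Let $\mathbb K=\mathbb R$ or $\mathbb C$, let $d\ge 2$, and let $\mathbb X=\{X\in \mathrm{Herm}(d,\mathbb K): X\gg 0,\ \det X=1\}$ be the symmetric space of $\mathrm{SL}(d,\mathbb K)$, with the action $g.X=gXg^\dagger$ and the invariant Riemannian metric $\langle X,Y\rangle_p=\tfrac12\mathrm{Tr}(p^{-1}Xp^{-1}Y)$. Let $\mathfrak a^+$ be the set of trace-free real diagonal matrices with non-increasing entries. For $x,y\in\mathbb X$ there is a unique $A=\mathrm{Diag}(a_1,\dots,a_d)\in\mathfrak a^+$ such that $x=g.I_d$ and $y=g\exp(A).I_d$ for some $g\in \mathrm{SL}(d,\mathbb K)$; put $d_\alpha(x,y)=a_1-a_2$. Let $\partial_{\rm vis}\mathbb X$ be the visual boundary (unit-speed geodesic rays up to asymptotic equivalence), and for a unit vector $A\in\mathfrak a^+$ (i.e. $2\,\mathrm{Tr}(A^2)=1$) let $c_A(t)=\exp(tA).I_d$. The Weyl chambers of $\partial_{\rm vis}\mathbb X$ are the sets $\{g[c_A] : A\in\mathfrak a^+,\ 2\,\mathrm{Tr}(A^2)=1\}$,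 $g\in \mathrm{SL}(d,\mathbb K)$. Points $\tau\in\mathbb{KP}^{d-1}$ are identified with ideal points by $g[e_1]\leftrightarrow g[c_Z]$, where $Z=\frac{1}{\sqrt{2d(d-1)}}\mathrm{Diag}(d-1,-1,\dots,-1)$. Let $\mathcal F\subset\partial_{\rm vis}\mathbb X$ be the manifold of line–hyperplane flags $(\ell\subset H)$ in $\mathbb K^d$, embedded by $g.([e_1],\langle e_1,\dots,e_{d-1}\rangle)\leftrightarrow g[c_W]$ with $W=\tfrac12\mathrm{Diag}(1,0,\dots,0,-1)$. The star $\mathrm{st}(\tau)$ is the union of all Weyl chambers containing $\tau$, and the Weyl cone $V(x,\mathrm{st}(\tau))$ is the union of all geodesic rays from $x$ with endpoint in $\mathrm{st}(\tau)$. A Busemann function centred at $\xi\in\partial_{\rm vis}\mathbb X$ is a function of the form $b(p)=\lim_{t\to\infty}\bigl(d(p,c(t))-t\bigr)+\text{const}$, where $c$ is a unit-speed geodesic ray with endpoint $\xi$ and $d$ is the Riemannian distance. Let $\tau\in\mathbb{KP}^{d-1}$ and $x,y\in\mathbb X$. If $y\in V(x,\mathrm{st}(\tau))$, then $$ d_\alpha(x,y)=\min\{\,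 b(x)-b(y) : b \text{ is a Busemann function centred at a point of } \mathcal F\cap\mathrm{st}(\tau)\,\}, $$ and in particular the minimum is attained. -/

import Mathlib

open scoped ComplexOrder Matrix Topology LinearAlgebra.Projectivization

/-- The symmetric space `𝕏` of `SL(d,𝕜)`: positive definite Hermitian matrices of determinant `1`. -/
def SymSpace (d : ℕ) (𝕜 : Type*) [RCLike 𝕜] : Type _ :=
  {p : Matrix (Fin d) (Fin d) 𝕜 // p.PosDef ∧ p.det = 1}

namespace SymSpace

section Basics

variable {d : ℕ} {𝕜 : Type*} [RCLike 𝕜]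

/-- The base point `I_d`. -/
def base : SymSpace d 𝕜 := ⟨1, Matrix.PosDef.one, Matrix.det_one⟩

/-- The action `g.p = g p g†` of `SL(d,𝕜)` on `𝕏`. -/
instance : SMul (Matrix.SpecialLinearGroup (Fin d) 𝕜) (SymSpace d 𝕜) where
  smul g p := ⟨g.1 * p.1 * g.1ᴴ, by
    have hg : IsUnit g.1 := (Matrix.isUnit_iff_isUnit_det _).2 (by rw [g.2]; exact isUnit_one)
    exact (Matrix.IsUnit.posDef_star_right_conjugate_iff hg).2 p.2.1, by
    simp [Matrix.det_mul, Matrix.det_conjTranspose, p.2.2]⟩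

theorem smul_val (g : Matrix.SpecialLinearGroup (Fin d) 𝕜) (p : SymSpace d 𝕜) :
    (g • p).1 = g.1 * p.1 * g.1ᴴ := rfl

theorem smul_base_val (g : Matrix.SpecialLinearGroup (Fin d) 𝕜) :
    (g • (base : SymSpace d 𝕜)).1 = g.1 * g.1ᴴ := by
  rw [smul_val]; simp only [base, mul_one]

/-- `exp(A) ∈ SL(d,𝕜)` for the trace-free real diagonal matrix `A = Diag(a_1,…,a_d)`. -/
noncomputable def expDiag (𝕜 : Type*) [RCLike 𝕜] (a : Fin d → ℝ) (ha : ∑ i, a i = 0) :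
    Matrix.SpecialLinearGroup (Fin d) 𝕜 :=
  ⟨Matrix.diagonal fun i => ((Real.exp (a i) : ℝ) : 𝕜), by
    rw [Matrix.det_diagonal, ← RCLike.ofReal_prod, ← Real.exp_sum, ha]; simp⟩

theorem flat_val (g : Matrix.SpecialLinearGroup (Fin d) 𝕜) (a : Fin d → ℝ)
    (ha : ∑ i, a i = 0) :
    (g • expDiag 𝕜 a ha • (base : SymSpace d 𝕜)).1 =
      g.1 * Matrix.diagonal (fun i => ((Real.exp (2 * a i) : ℝ) : 𝕜)) * g.1ᴴ := by
  rw [smul_val, smul_val]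
  congr 2
  simp only [expDiag, base, mul_one, Matrix.diagonal_conjTranspose, Matrix.diagonal_mul_diagonal]
  congr 1
  funext i
  simp only [Pi.star_apply, RCLike.star_def, RCLike.conj_ofReal]
  rw [← RCLike.ofReal_mul, ← Real.exp_add]
  ring_nf

end Basics

section VectorDistance

variable {d : ℕ} {𝕜 : Type*} [RCLike 𝕜]

/-- Spectral decomposition by an element of `SU(d,𝕜)`, with sorted eigenvalues. -/
theorem exists_spectral [d.AtLeastTwo] (q : Matrix (Fin d) (Fin d) 𝕜) (hq : q.PosDef)
    (hdet : q.det = 1) :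
    ∃ (k : Matrix.SpecialLinearGroup (Fin d) 𝕜) (a : Fin d → ℝ), Antitone a ∧ ∑ i, a i = 0 ∧
      k.1 * k.1ᴴ = 1 ∧
      q = k.1 * Matrix.diagonal (fun i => ((Real.exp (2 * a i) : ℝ) : 𝕜)) * k.1ᴴ := by
  classical
  have hH := hq.isHermitian
  set ev := hH.eigenvalues with hev
  have hpos : ∀ i, 0 < ev i := fun i => hq.eigenvalues_pos i
  set σ := Tuple.sort (fun i => - ev i) with hσ
  have hanti : Antitone (ev ∘ σ) := by
    intro i j hij
    have := Tuple.monotone_sort (fun i => - ev i) hij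
    simpa using this
  set U : Matrix (Fin d) (Fin d) 𝕜 := hH.eigenvectorUnitary.1 with hU
  have hUU : U * Uᴴ = 1 := Unitary.coe_mul_star_self hH.eigenvectorUnitary
  set V : Matrix (Fin d) (Fin d) 𝕜 := U.submatrix id σ with hV
  have hVV : V * Vᴴ = 1 := by
    rw [← hUU, hV, Matrix.conjTranspose_submatrix,
      Matrix.submatrix_mul_equiv U Uᴴ id σ id, Matrix.submatrix_id_id]
  have hqU : q = U * Matrix.diagonal (fun i => ((ev i : ℝ) : 𝕜)) * Uᴴ := by
    have := hH.spectral_theorem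
    rw [Unitary.conjStarAlgAut_apply] at this
    exact this
  have hqV : q = V * Matrix.diagonal (fun i => ((ev (σ i) : ℝ) : 𝕜)) * Vᴴ := by
    have h1 : Matrix.diagonal (fun i => ((ev (σ i) : ℝ) : 𝕜)) =
        (Matrix.diagonal (fun i => ((ev i : ℝ) : 𝕜))).submatrix σ σ := by
      rw [Matrix.submatrix_diagonal_equiv]; rfl
    rw [h1, hV, Matrix.conjTranspose_submatrix, Matrix.submatrix_mul_equiv,
      Matrix.submatrix_mul_equiv, Matrix.submatrix_id_id]
    exact hqU
  have hdV : V.det * star V.det = 1 := by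
    rw [← Matrix.det_conjTranspose, ← Matrix.det_mul, hVV, Matrix.det_one]
  have hdV0 : V.det ≠ 0 := left_ne_zero_of_mul_eq_one hdV
  set c : Fin d → 𝕜 := Function.update 1 0 (V.det)⁻¹ with hc
  have hcc : ∀ i, c i * star (c i) = 1 := by
    intro i
    by_cases hi : i = 0
    · subst hi
      simp only [hc, Function.update_self]
      rw [star_inv₀, ← mul_inv, hdV, inv_one]
    · simp [hc, Function.update_of_ne hi]
  have hcdet : ∏ i, c i = (V.det)⁻¹ := by
    rw [hc, Finset.prod_update_of_mem (Finset.mem_univ _)]; simp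
  have hW : ∀ f : Fin d → 𝕜, (V * Matrix.diagonal c) * Matrix.diagonal f *
      (V * Matrix.diagonal c)ᴴ = V * Matrix.diagonal f * Vᴴ := by
    intro f
    rw [Matrix.conjTranspose_mul, Matrix.diagonal_conjTranspose]
    have : Matrix.diagonal c * Matrix.diagonal f * Matrix.diagonal (star c) =
        Matrix.diagonal f := by
      rw [Matrix.diagonal_mul_diagonal, Matrix.diagonal_mul_diagonal]
      congr 1; funext i
      have := hcc i
      simp only [Pi.star_apply]
      linear_combination (f i) * this
    calc _ = V * (Matrix.diagonal c * Matrix.diagonal f * Matrix.diagonal (star c)) * Vᴴ := by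
          simp only [Matrix.mul_assoc]
      _ = _ := by rw [this]
  refine ⟨⟨V * Matrix.diagonal c, ?_⟩, fun i => Real.log (ev (σ i)) / 2, ?_, ?_, ?_, ?_⟩
  · rw [Matrix.det_mul, Matrix.det_diagonal, hcdet, mul_inv_cancel₀ hdV0]
  · intro i j hij
    have := Real.log_le_log (hpos _) (hanti hij)
    simp only [Function.comp] at this
    linarith
  · rw [← Finset.sum_div, ← Real.log_prod (fun i _ => (hpos _).ne')]
    have h1 : ∏ i, ev (σ i) = 1 := by
      rw [Equiv.prod_comp σ ev]
      have := hH.det_eq_prod_eigenvalues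
      rw [hdet] at this
      exact_mod_cast this.symm
    rw [h1]; simp
  · have := hW 1
    simpa [hVV] using this
  · have h1 : (fun i => ((Real.exp (2 * (Real.log (ev (σ i)) / 2)) : ℝ) : 𝕜)) =
        fun i => ((ev (σ i) : ℝ) : 𝕜) := by
      funext i
      rw [mul_div_cancel₀ _ (two_ne_zero), Real.exp_log (hpos _)]
    simp only [h1]
    rw [hW]
    exact hqV

/-- `a ∈ 𝔞⁺` (trace-free with non-increasing entries) is the vector-valued invariant of the
geodesic segment from `x` to `y`: some `g` carries `I_d` to `x` and `exp(A).I_d` to `y`. -/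
def IsVectorDist (x y : SymSpace d 𝕜) (a : Fin d → ℝ) : Prop :=
  Antitone a ∧ ∃ (ha : ∑ i, a i = 0) (g : Matrix.SpecialLinearGroup (Fin d) 𝕜),
    x = g • base ∧ y = g • expDiag 𝕜 a ha • base

theorem exists_isVectorDist [d.AtLeastTwo] (x y : SymSpace d 𝕜) : ∃ a, IsVectorDist x y a := by
  obtain ⟨k, b, -, hb, -, hx⟩ := exists_spectral x.1 x.2.1 x.2.2
  set h : Matrix.SpecialLinearGroup (Fin d) 𝕜 := k * expDiag 𝕜 b hb with hh
  have hx' : x = h • base := by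
    apply Subtype.ext
    rw [hx, ← flat_val k b hb, hh]
    simp [smul_val, Matrix.mul_assoc]
  have hinv : (h⁻¹ : Matrix.SpecialLinearGroup (Fin d) 𝕜).1 * h.1 = 1 := by
    exact congrArg Subtype.val (inv_mul_cancel h)
  have hinv' : h.1 * (h⁻¹ : Matrix.SpecialLinearGroup (Fin d) 𝕜).1 = 1 := by
    exact congrArg Subtype.val (mul_inv_cancel h)
  obtain ⟨l, a, ha, ha0, hl, hq⟩ := exists_spectral (h⁻¹ • y).1 (h⁻¹ • y).2.1 (h⁻¹ • y).2.2
  refine ⟨a, ha, ha0, h * l, ?_, ?_⟩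
  · rw [hx']
    apply Subtype.ext
    have : h.1 * (l.1 * l.1ᴴ) * h.1ᴴ = h.1 * h.1ᴴ := by rw [hl, mul_one]
    rw [smul_base_val, smul_base_val]
    simpa [Matrix.mul_assoc] using this.symm
  · apply Subtype.ext
    have hy : y.1 = h.1 * (h⁻¹ • y).1 * h.1ᴴ := by
      rw [smul_val]
      calc y.1 = (h.1 * (h⁻¹ : Matrix.SpecialLinearGroup (Fin d) 𝕜).1) * y.1 *
            (h.1 * (h⁻¹ : Matrix.SpecialLinearGroup (Fin d) 𝕜).1)ᴴ := by rw [hinv']; simp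
        _ = _ := by rw [Matrix.conjTranspose_mul]; simp only [Matrix.mul_assoc]
    rw [flat_val, hy, hq]
    simp [Matrix.mul_assoc]

theorem IsVectorDist.unique {x y : SymSpace d 𝕜} {a b : Fin d → ℝ}
    (ha : IsVectorDist x y a) (hb : IsVectorDist x y b) : a = b := by
  have key : ∀ {a : Fin d → ℝ}, IsVectorDist x y a → (y.1 * x.1⁻¹).charpoly.roots =
      Multiset.map (fun i => ((Real.exp (2 * a i) : ℝ) : 𝕜)) Finset.univ.val := by
    rintro a ⟨-, ha0, g, hx, hy⟩
    have hg : IsUnit g.1.det := by rw [g.2]; exact isUnit_one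
    have hg' : IsUnit g.1ᴴ.det := by rw [Matrix.det_conjTranspose, g.2]; simp
    have hx1 : x.1 = g.1 * g.1ᴴ := by rw [hx, smul_base_val]
    have : y.1 * x.1⁻¹ =
        g.1 * Matrix.diagonal (fun i => ((Real.exp (2 * a i) : ℝ) : 𝕜)) * g.1⁻¹ := by
      rw [hx1, hy, flat_val, Matrix.mul_inv_rev, ← Matrix.mul_assoc,
        Matrix.mul_nonsing_inv_cancel_right _ _ hg']
    rw [this, Matrix.charpoly_mul_comm, ← Matrix.mul_assoc, Matrix.nonsing_inv_mul _ hg,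
      Matrix.one_mul, Matrix.charpoly_diagonal, Polynomial.roots_prod]
    · simp
    · simp [Finset.prod_ne_zero_iff, Polynomial.X_sub_C_ne_zero]
  have h := (key ha).symm.trans (key hb)
  have h2 := congrArg (Multiset.map (fun z : 𝕜 => Real.log (RCLike.re z) / 2)) h
  simp only [Multiset.map_map, Function.comp_def, RCLike.ofReal_re, Real.log_exp] at h2
  have h3 : Multiset.map a Finset.univ.val = Multiset.map b Finset.univ.val := by
    simpa using h2
  rw [Fin.univ_val_map, Fin.univ_val_map, Multiset.coe_eq_coe] at h3
  exact List.ofFn_injective (h3.eq_of_sortedGE ha.1.sortedGE_ofFn hb.1.sortedGE_ofFn)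

/-- The vector-valued distance: the unique `a ∈ 𝔞⁺` attached to the segment from `x` to `y`. -/
noncomputable def vectorDist [d.AtLeastTwo] (x y : SymSpace d 𝕜) : Fin d → ℝ :=
  (exists_isVectorDist x y).choose

theorem vectorDist_spec [d.AtLeastTwo] (x y : SymSpace d 𝕜) :
    IsVectorDist x y (vectorDist x y) := (exists_isVectorDist x y).choose_spec

/-- The first simple root pseudometric `d_α(x,y) = a₁ - a₂`. -/
noncomputable def rootDist [d.AtLeastTwo] (x y : SymSpace d 𝕜) : ℝ :=
  vectorDist x y 0 - vectorDist x y 1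

end VectorDistance

section Riemannian

variable {d : ℕ} {𝕜 : Type*} [RCLike 𝕜]

/-- The Riemannian norm `‖X‖_p = (½ Tr(p⁻¹ X p⁻¹ X))^{1/2}` of a tangent vector `X` at `p`. -/
noncomputable def tangentNorm (p : SymSpace d 𝕜) (X : Matrix (Fin d) (Fin d) 𝕜) : ℝ :=
  √(RCLike.re (Matrix.trace (p.1⁻¹ * X * p.1⁻¹ * X)) / 2)

/-- The entrywise derivative of a curve of matrices. -/
noncomputable def velocity (γ : ℝ → Matrix (Fin d) (Fin d) 𝕜) (t : ℝ) :
    Matrix (Fin d) (Fin d) 𝕜 :=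
  Matrix.of fun i j => deriv (fun s => γ s i j) t

/-- The length of the `C¹` path `γ : [0,1] → 𝕏`. -/
noncomputable def pathLength (γ : ℝ → SymSpace d 𝕜) : ℝ :=
  ∫ t in (0 : ℝ)..1, tangentNorm (γ t) (velocity (fun s => (γ s).1) t)

/-- `x` and `y` are joined by a piecewise `C¹` path of length `L`. -/
inductive JoinedByLength : SymSpace d 𝕜 → SymSpace d 𝕜 → ℝ → Prop
  | path (γ : ℝ → SymSpace d 𝕜) (hγ : ∀ i j, ContDiff ℝ 1 fun t => (γ t).1 i j) :
      JoinedByLength (γ 0) (γ 1) (pathLength γ)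
  | concat {x y z : SymSpace d 𝕜} {L M : ℝ} :
      JoinedByLength x y L → JoinedByLength y z M → JoinedByLength x z (L + M)

/-- The Riemannian distance: the infimum of the lengths of piecewise `C¹` paths. -/
noncomputable def riemDist (x y : SymSpace d 𝕜) : ℝ := sInf {L | JoinedByLength x y L}

theorem pathLength_nonneg (γ : ℝ → SymSpace d 𝕜) : 0 ≤ pathLength γ :=
  intervalIntegral.integral_nonneg zero_le_one fun _ _ => Real.sqrt_nonneg _

theorem JoinedByLength.nonneg {x y : SymSpace d 𝕜} {L : ℝ} (h : JoinedByLength x y L) :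
    0 ≤ L := by
  induction h with
  | path γ _ => exact pathLength_nonneg γ
  | concat _ _ h1 h2 => exact add_nonneg h1 h2

theorem tangentNorm_neg (p : SymSpace d 𝕜) (X : Matrix (Fin d) (Fin d) 𝕜) :
    tangentNorm p (-X) = tangentNorm p X := by simp [tangentNorm]

theorem JoinedByLength.symm {x y : SymSpace d 𝕜} {L : ℝ} (h : JoinedByLength x y L) :
    JoinedByLength y x L := by
  induction h with
  | path γ hγ =>
    have h := JoinedByLength.path (fun t => γ (1 - t))
      (fun i j => (hγ i j).comp (contDiff_const.sub contDiff_id))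
    have hv : ∀ t, velocity (fun s => (γ (1 - s)).1) t =
        -velocity (fun s => (γ s).1) (1 - t) := by
      intro t
      ext i j
      exact deriv_comp_const_sub (f := fun s => (γ s).1 i j) 1 t
    have hl : pathLength (fun t => γ (1 - t)) = pathLength γ := by
      simp only [pathLength, hv, tangentNorm_neg]
      rw [intervalIntegral.integral_comp_sub_left
        (fun t => tangentNorm (γ t) (velocity (fun s => (γ s).1) t)) 1]
      simp
    simpa [hl] using h
  | concat _ _ h1 h2 => rw [add_comm]; exact h2.concat h1

/-- The curve `t ↦ g exp(tA).I_d`. -/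
noncomputable def flatCurve (g : Matrix.SpecialLinearGroup (Fin d) 𝕜) (a : Fin d → ℝ)
    (ha : ∑ i, a i = 0) (t : ℝ) : SymSpace d 𝕜 :=
  g • expDiag 𝕜 (fun i => t * a i) (by rw [← Finset.mul_sum, ha, mul_zero]) • base

theorem flatCurve_val (g : Matrix.SpecialLinearGroup (Fin d) 𝕜) (a : Fin d → ℝ)
    (ha : ∑ i, a i = 0) (t : ℝ) :
    (flatCurve g a ha t).1 =
      g.1 * Matrix.diagonal (fun i => ((Real.exp (2 * a i * t) : ℝ) : 𝕜)) * g.1ᴴ := by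
  rw [flatCurve, flat_val]
  congr 3; funext i; ring_nf

theorem hasDerivAt_flat (g : Matrix (Fin d) (Fin d) 𝕜) (a c : Fin d → ℝ) (i j : Fin d)
    (t : ℝ) : HasDerivAt (fun s : ℝ =>
        (g * Matrix.diagonal (fun i => ((c i * Real.exp (a i * s) : ℝ) : 𝕜)) * gᴴ) i j)
      ((g * Matrix.diagonal (fun i => ((c i * a i * Real.exp (a i * t) : ℝ) : 𝕜)) * gᴴ) i j)
      t := by
  simp only [Matrix.mul_apply (M := _ * _), Matrix.mul_diagonal]
  refine HasDerivAt.fun_sum fun k _ => ?_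
  refine HasDerivAt.mul_const (HasDerivAt.const_mul _ ?_) _
  have h1 : HasDerivAt (fun s : ℝ => c k * Real.exp (a k * s))
      (c k * a k * Real.exp (a k * t)) t := by
    have := (((hasDerivAt_id t).const_mul (a k)).exp).const_mul (c k)
    simpa [mul_comm, mul_left_comm, mul_assoc] using this
  exact (RCLike.ofRealCLM (K := 𝕜)).hasFDerivAt.comp_hasDerivAt t h1

theorem contDiff_flatCurve (g : Matrix.SpecialLinearGroup (Fin d) 𝕜) (a : Fin d → ℝ)
    (ha : ∑ i, a i = 0) (n : WithTop ℕ∞) (i j : Fin d) :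
    ContDiff ℝ n fun t => (flatCurve g a ha t).1 i j := by
  simp only [flatCurve_val, Matrix.mul_apply (M := _ * _), Matrix.mul_diagonal]
  refine ContDiff.sum fun k _ => ?_
  refine ContDiff.mul (ContDiff.mul contDiff_const ?_) contDiff_const
  have h1 : ContDiff ℝ n fun s : ℝ => Real.exp (2 * a k * s) := by fun_prop
  exact (RCLike.ofRealCLM (K := 𝕜)).contDiff.comp h1

theorem exists_joinedByLength [d.AtLeastTwo] (x y : SymSpace d 𝕜) :
    ∃ L, JoinedByLength x y L := by
  obtain ⟨a, -, ha, g, hx, hy⟩ := exists_isVectorDist x y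
  have h := JoinedByLength.path (flatCurve g a ha) (contDiff_flatCurve g a ha 1)
  have h0 : flatCurve g a ha 0 = x := by
    rw [hx]; apply Subtype.ext; rw [flatCurve_val, smul_base_val]; simp
  have h1 : flatCurve g a ha 1 = y := by
    rw [hy]; simp [flatCurve]
  rw [h0, h1] at h
  exact ⟨_, h⟩

theorem riemDist_comm (x y : SymSpace d 𝕜) : riemDist x y = riemDist y x := by
  unfold riemDist
  congr 1
  ext L
  exact ⟨fun h => h.symm, fun h => h.symm⟩

theorem bddBelow_joined (x y : SymSpace d 𝕜) : BddBelow {L | JoinedByLength x y L} :=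
  ⟨0, fun _ h => h.nonneg⟩

theorem riemDist_triangle [d.AtLeastTwo] (x y z : SymSpace d 𝕜) :
    riemDist x z ≤ riemDist x y + riemDist y z := by
  refine le_of_forall_pos_le_add fun ε hε => ?_
  obtain ⟨L, hL, hL'⟩ := exists_lt_of_csInf_lt (s := {L | JoinedByLength x y L})
    (exists_joinedByLength x y) (lt_add_of_pos_right (riemDist x y) (half_pos hε))
  obtain ⟨M, hM, hM'⟩ := exists_lt_of_csInf_lt (s := {L | JoinedByLength y z L})
    (exists_joinedByLength y z) (lt_add_of_pos_right (riemDist y z) (half_pos hε))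
  have := csInf_le (bddBelow_joined x z) (JoinedByLength.concat hL hM)
  unfold riemDist at *
  linarith

theorem riemDist_self [d.AtLeastTwo] (x : SymSpace d 𝕜) : riemDist x x = 0 := by
  apply le_antisymm _ (Real.sInf_nonneg fun _ h => JoinedByLength.nonneg h)
  have h := JoinedByLength.path (fun _ : ℝ => x) (fun i j => contDiff_const)
  have h0 : pathLength (fun _ : ℝ => x) = 0 := by
    have hv : ∀ t, velocity (fun _ : ℝ => x.1) t = 0 := by
      intro t; ext i j; simp [velocity]
    simp [pathLength, hv, tangentNorm]
  rw [h0] at h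
  exact csInf_le (bddBelow_joined x x) h

end Riemannian

section Boundary

/-- A unit-speed geodesic ray, given as the restriction to `[0,∞)` of the complete geodesic
`ℝ → 𝕏` that extends it (`𝕏` is complete). For the metric `½ Tr(p⁻¹ X p⁻¹ Y)` the Levi-Civita
covariant derivative of `c'` along `c` is `c'' - c' c⁻¹ c'`, so `geodesic` is the geodesic
equation. -/
structure GeodesicRay (d : ℕ) (𝕜 : Type*) [RCLike 𝕜] where
  toFun : ℝ → SymSpace d 𝕜
  contDiff : ∀ i j, ContDiff ℝ (⊤ : ℕ∞) fun t => (toFun t).1 i j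
  geodesic : ∀ t, velocity (velocity fun s => (toFun s).1) t =
    velocity (fun s => (toFun s).1) t * (toFun t).1⁻¹ * velocity (fun s => (toFun s).1) t
  unit_speed : ∀ t, tangentNorm (toFun t) (velocity (fun s => (toFun s).1) t) = 1

variable {d : ℕ} {𝕜 : Type*} [RCLike 𝕜]

/-- Two rays are asymptotic if they stay at bounded distance. -/
def Asymptotic (c c' : GeodesicRay d 𝕜) : Prop :=
  ∃ C, ∀ t, 0 ≤ t → riemDist (c.toFun t) (c'.toFun t) ≤ C

instance asymptoticSetoid (d : ℕ) (𝕜 : Type*) [RCLike 𝕜] [d.AtLeastTwo] :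
    Setoid (GeodesicRay d 𝕜) where
  r := Asymptotic
  iseqv :=
    { refl := fun c => ⟨0, fun _ _ => (riemDist_self _).le⟩
      symm := fun ⟨C, h⟩ => ⟨C, fun t ht => by rw [riemDist_comm]; exact h t ht⟩
      trans := fun ⟨C, h⟩ ⟨D, h'⟩ =>
        ⟨C + D, fun t ht => (riemDist_triangle _ _ _).trans (add_le_add (h t ht) (h' t ht))⟩ }

/-- The visual boundary: unit-speed geodesic rays up to asymptotic equivalence. -/
def VisualBoundary (d : ℕ) (𝕜 : Type*) [RCLike 𝕜] [d.AtLeastTwo] : Type _ :=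
  Quotient (asymptoticSetoid d 𝕜)

/-- The ideal endpoint `c(+∞)`. -/
def GeodesicRay.endpoint [d.AtLeastTwo] (c : GeodesicRay d 𝕜) : VisualBoundary d 𝕜 :=
  Quotient.mk _ c

/-- The model Weyl chamber `σ_mod`: unit vectors of `𝔞⁺` for the inner product `2 Tr(AB)`. -/
def ModelChamber (d : ℕ) : Type :=
  {a : Fin d → ℝ // Antitone a ∧ ∑ i, a i = 0 ∧ 2 * ∑ i, a i ^ 2 = 1}

/-- The unit-speed ray `t ↦ g exp(tA).I_d`. -/
noncomputable def standardRay (g : Matrix.SpecialLinearGroup (Fin d) 𝕜) (A : ModelChamber d) :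
    GeodesicRay d 𝕜 :=
  have hg : IsUnit g.1.det := by rw [g.2]; exact isUnit_one
  have hg' : IsUnit g.1ᴴ.det := by rw [Matrix.det_conjTranspose, g.2]; simp
  have hv : ∀ t, velocity (fun s => (flatCurve g A.1 A.2.2.1 s).1) t = g.1 * Matrix.diagonal
      (fun i => ((2 * A.1 i * Real.exp (2 * A.1 i * t) : ℝ) : 𝕜)) * g.1ᴴ := by
    intro t
    ext i j
    have := (hasDerivAt_flat g.1 (fun i => 2 * A.1 i) (fun _ => 1) i j t).deriv
    simpa only [velocity, Matrix.of_apply, flatCurve_val, one_mul] using this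
  have hvv : ∀ t, velocity (velocity fun s => (flatCurve g A.1 A.2.2.1 s).1) t =
      g.1 * Matrix.diagonal (fun i =>
        ((2 * A.1 i * (2 * A.1 i) * Real.exp (2 * A.1 i * t) : ℝ) : 𝕜)) * g.1ᴴ := by
    intro t
    ext i j
    have := (hasDerivAt_flat g.1 (fun i => 2 * A.1 i) (fun i => 2 * A.1 i) i j t).deriv
    rw [funext hv]
    simpa only [velocity, Matrix.of_apply] using this
  have hinv : ∀ t, (flatCurve g A.1 A.2.2.1 t).1⁻¹ = (g.1ᴴ)⁻¹ * Matrix.diagonal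
      (fun i => ((Real.exp (-(2 * A.1 i * t)) : ℝ) : 𝕜)) * g.1⁻¹ := by
    intro t
    refine Matrix.inv_eq_left_inv ?_
    rw [flatCurve_val]
    have : Matrix.diagonal (fun i => ((Real.exp (-(2 * A.1 i * t)) : ℝ) : 𝕜)) *
        Matrix.diagonal (fun i => ((Real.exp (2 * A.1 i * t) : ℝ) : 𝕜)) = 1 := by
      rw [Matrix.diagonal_mul_diagonal, ← Matrix.diagonal_one]
      congr 1; funext i
      rw [← RCLike.ofReal_mul, ← Real.exp_add]; simp
    calc _ = (g.1ᴴ)⁻¹ * (Matrix.diagonal (fun i => ((Real.exp (-(2 * A.1 i * t)) : ℝ) : 𝕜)) *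
          (g.1⁻¹ * g.1) * Matrix.diagonal (fun i => ((Real.exp (2 * A.1 i * t) : ℝ) : 𝕜))) *
          g.1ᴴ := by simp only [Matrix.mul_assoc]
      _ = 1 := by
        rw [Matrix.nonsing_inv_mul _ hg, Matrix.mul_one, this, Matrix.mul_one,
          Matrix.nonsing_inv_mul _ hg']
  have hpv : ∀ t, (flatCurve g A.1 A.2.2.1 t).1⁻¹ *
      velocity (fun s => (flatCurve g A.1 A.2.2.1 s).1) t =
      (g.1ᴴ)⁻¹ * Matrix.diagonal (fun i => ((2 * A.1 i : ℝ) : 𝕜)) * g.1ᴴ := by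
    intro t
    rw [hinv, hv]
    calc _ = (g.1ᴴ)⁻¹ * (Matrix.diagonal (fun i => ((Real.exp (-(2 * A.1 i * t)) : ℝ) : 𝕜)) *
          (g.1⁻¹ * g.1) * Matrix.diagonal
            (fun i => ((2 * A.1 i * Real.exp (2 * A.1 i * t) : ℝ) : 𝕜))) *
          g.1ᴴ := by simp only [Matrix.mul_assoc]
      _ = _ := by
        rw [Matrix.nonsing_inv_mul _ hg, Matrix.mul_one, Matrix.diagonal_mul_diagonal]
        congr 3; funext i
        rw [← RCLike.ofReal_mul, mul_left_comm, ← Real.exp_add]; simp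
  { toFun := flatCurve g A.1 A.2.2.1
    contDiff := contDiff_flatCurve g A.1 A.2.2.1 _
    geodesic := by
      intro t
      rw [Matrix.mul_assoc, hpv, hvv, hv]
      symm
      calc _ = g.1 * (Matrix.diagonal
            (fun i => ((2 * A.1 i * Real.exp (2 * A.1 i * t) : ℝ) : 𝕜)) *
            (g.1ᴴ * (g.1ᴴ)⁻¹) * Matrix.diagonal (fun i => ((2 * A.1 i : ℝ) : 𝕜))) * g.1ᴴ := by
            simp only [Matrix.mul_assoc]
        _ = _ := by
          rw [Matrix.mul_nonsing_inv _ hg', Matrix.mul_one, Matrix.diagonal_mul_diagonal]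
          congr 3; funext i
          rw [← RCLike.ofReal_mul]; ring_nf
    unit_speed := by
      intro t
      have h1 : ((g.1ᴴ)⁻¹ * Matrix.diagonal (fun i => ((2 * A.1 i : ℝ) : 𝕜)) * g.1ᴴ) *
          ((g.1ᴴ)⁻¹ * Matrix.diagonal (fun i => ((2 * A.1 i : ℝ) : 𝕜)) * g.1ᴴ) =
          (g.1ᴴ)⁻¹ * Matrix.diagonal (fun i => (((2 * A.1 i) ^ 2 : ℝ) : 𝕜)) * g.1ᴴ := by
        calc _ = (g.1ᴴ)⁻¹ * (Matrix.diagonal (fun i => ((2 * A.1 i : ℝ) : 𝕜)) *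
            (g.1ᴴ * (g.1ᴴ)⁻¹) * Matrix.diagonal (fun i => ((2 * A.1 i : ℝ) : 𝕜))) * g.1ᴴ := by
              simp only [Matrix.mul_assoc]
          _ = _ := by
            rw [Matrix.mul_nonsing_inv _ hg', Matrix.mul_one, Matrix.diagonal_mul_diagonal]
            congr 3; funext i
            rw [← RCLike.ofReal_mul]; ring_nf
      rw [tangentNorm, Matrix.mul_assoc, hpv, h1, Matrix.trace_mul_comm, ← Matrix.mul_assoc,
        Matrix.mul_nonsing_inv _ hg', Matrix.one_mul, Matrix.trace_diagonal,
        ← RCLike.ofReal_sum, RCLike.ofReal_re, Real.sqrt_eq_one]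
      have := A.2.2.2
      have h2 : ∑ i, (2 * A.1 i) ^ 2 = 4 * ∑ i, A.1 i ^ 2 := by
        rw [Finset.mul_sum]; congr 1; funext i; ring
      rw [h2]; linarith }

variable [d.AtLeastTwo]

/-- The Weyl chamber `g σ_mod` in the visual boundary. -/
def weylChamber (g : Matrix.SpecialLinearGroup (Fin d) 𝕜) : Set (VisualBoundary d 𝕜) :=
  {ξ | ∃ A : ModelChamber d, ξ = (standardRay g A).endpoint}

/-- The unit vector `Z = (2d(d-1))^{-1/2} Diag(d-1,-1,…,-1)`. -/
noncomputable def lineType (d : ℕ) [d.AtLeastTwo] : ModelChamber d :=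
  ⟨fun i => (if i = 0 then (d : ℝ) - 1 else -1) / √(2 * d * (d - 1)), by
    have hd : (2 : ℝ) ≤ d := by exact_mod_cast Nat.AtLeastTwo.prop (n := d)
    have hs : ∀ x y : ℝ, ∑ i : Fin d, (if i = 0 then x else y) = x + (d - 1) * y := by
      intro x y
      rw [← Finset.add_sum_erase _ _ (Finset.mem_univ (0 : Fin d)), if_pos rfl,
        Finset.sum_congr rfl (fun i hi => if_neg (Finset.ne_of_mem_erase hi)),
        Finset.sum_const, Finset.card_erase_of_mem (Finset.mem_univ _), Finset.card_univ,
        Fintype.card_fin, nsmul_eq_mul, Nat.cast_sub (by exact_mod_cast (by linarith : (1:ℝ) ≤ d))]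
      simp
    refine ⟨?_, ?_, ?_⟩
    · intro i j hij
      refine div_le_div_of_nonneg_right ?_ (Real.sqrt_nonneg _)
      by_cases hj : j = 0
      · have hi : i = 0 := nonpos_iff_eq_zero.1 (hj ▸ hij)
        simp [hi, hj]
      · rw [if_neg hj]
        split_ifs <;> linarith
    · rw [← Finset.sum_div, hs]; simp
    · have h0 : (0 : ℝ) < 2 * d * (d - 1) := by nlinarith
      have h1 : ∀ i : Fin d, ((if i = 0 then (d : ℝ) - 1 else -1) / √(2 * d * (d - 1))) ^ 2 =
          (if i = 0 then ((d : ℝ) - 1) ^ 2 else 1) / (2 * d * (d - 1)) := by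
        intro i
        rw [div_pow, Real.sq_sqrt h0.le]
        split_ifs <;> simp
      simp only [h1]
      rw [← Finset.sum_div, hs, mul_div_assoc', div_eq_one_iff_eq h0.ne']
      ring⟩

/-- The unit vector `½ Diag(1,0,…,0,-1)` (the direction of the coroot of `A ↦ a₁ - a_d`);
`Fin.rev 0` is the last index. -/
noncomputable def flagType (d : ℕ) [d.AtLeastTwo] : ModelChamber d :=
  ⟨fun i => if i = 0 then 1 / 2 else if i = Fin.rev 0 then -1 / 2 else 0, by
    have hd : 2 ≤ d := Nat.AtLeastTwo.prop
    have h0 : (Fin.rev 0 : Fin d) ≠ 0 := by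
      intro h
      have := congrArg Fin.val h
      simp [Fin.val_rev] at this
      omega
    have hs : ∀ x y : ℝ, ∑ i : Fin d, (if i = 0 then x else if i = Fin.rev 0 then y else 0) =
        x + y := by
      intro x y
      rw [← Finset.add_sum_erase _ _ (Finset.mem_univ (0 : Fin d)), if_pos rfl,
        Finset.sum_congr rfl (fun i hi => if_neg (Finset.ne_of_mem_erase hi)),
        Finset.sum_ite_eq', if_pos (Finset.mem_erase.2 ⟨h0, Finset.mem_univ _⟩)]
    refine ⟨?_, ?_, ?_⟩
    · intro i j hij
      by_cases hj : j = 0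
      · have hi : i = 0 := nonpos_iff_eq_zero.1 (hj ▸ hij)
        simp [hi, hj]
      · by_cases hi : i = Fin.rev 0
        · have hj' : j = Fin.rev 0 := by
            apply Fin.ext
            have h1 : i.val ≤ j.val := hij
            have h2 := congrArg Fin.val hi
            have h3 := j.isLt
            simp [Fin.val_rev] at h2 ⊢
            omega
          simp [hi, hj']
        · simp only [if_neg hj, if_neg hi]
          split_ifs <;> norm_num
    · rw [hs]; norm_num
    · have h1 : ∀ i : Fin d, (if i = 0 then (1 : ℝ) / 2 else
          if i = Fin.rev 0 then -1 / 2 else 0) ^ 2 =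
          if i = 0 then 1 / 4 else if i = Fin.rev 0 then 1 / 4 else 0 := by
        intro i
        split_ifs <;> norm_num
      simp only [h1]
      rw [hs]; norm_num⟩

/-- `ξ` is the ideal point identified with the line `τ ∈ 𝕜ℙ^{d-1}`, under the identification
`g[c_Z] ↔ g[e₁]`. -/
def IsLinePoint (τ : ℙ 𝕜 (Fin d → 𝕜)) (ξ : VisualBoundary d 𝕜) : Prop :=
  ∃ g : Matrix.SpecialLinearGroup (Fin d) 𝕜,
    τ.submodule = Submodule.span 𝕜 {g.1 *ᵥ Pi.single 0 1} ∧
      ξ = (standardRay g (lineType d)).endpoint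

/-- The star of (the vertex) `τ`: the union of all Weyl chambers containing it. -/
def star (τ : ℙ 𝕜 (Fin d → 𝕜)) : Set (VisualBoundary d 𝕜) :=
  {ξ | ∃ g : Matrix.SpecialLinearGroup (Fin d) 𝕜,
    (∃ ζ ∈ weylChamber g, IsLinePoint τ ζ) ∧ ξ ∈ weylChamber g}

/-- The Weyl cone `V(o, S)`: the union of the geodesic rays from `o` with endpoint in `S`. -/
def weylCone (o : SymSpace d 𝕜) (S : Set (VisualBoundary d 𝕜)) : Set (SymSpace d 𝕜) :=
  {y | ∃ c : GeodesicRay d 𝕜, c.toFun 0 = o ∧ c.endpoint ∈ S ∧ ∃ t, 0 ≤ t ∧ y = c.toFun t}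

/-- A line–hyperplane flag in `𝕜^d`. -/
structure LineHyperplaneFlag (d : ℕ) (𝕜 : Type*) [RCLike 𝕜] where
  line : ℙ 𝕜 (Fin d → 𝕜)
  hyperplane : Submodule 𝕜 (Fin d → 𝕜)
  isCoatom : IsCoatom hyperplane
  line_le : line.submodule ≤ hyperplane

/-- `ξ` is the ideal point identified with the flag `f`, under the identification of
`g[c_W]`, `W = ½ Diag(1,0,…,0,-1)`, with `g([e₁], {v : v_d = 0})`. -/
def IsFlagPoint (f : LineHyperplaneFlag d 𝕜) (ξ : VisualBoundary d 𝕜) : Prop :=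
  ∃ g : Matrix.SpecialLinearGroup (Fin d) 𝕜,
    f.line.submodule = Submodule.span 𝕜 {g.1 *ᵥ Pi.single 0 1} ∧
    f.hyperplane = Submodule.map g.1.mulVecLin
      (LinearMap.ker (LinearMap.proj (R := 𝕜) (φ := fun _ : Fin d => 𝕜) (Fin.rev 0))) ∧
    ξ = (standardRay g (flagType d)).endpoint

/-- The flag manifold `𝓕` of line–hyperplane flags, as a subset of the visual boundary. -/
def flagManifold (d : ℕ) (𝕜 : Type*) [RCLike 𝕜] [d.AtLeastTwo] : Set (VisualBoundary d 𝕜) :=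
  {ξ | ∃ f : LineHyperplaneFlag d 𝕜, IsFlagPoint f ξ}

/-- `b` is a Busemann function centred at `ξ`: up to an additive constant it is
`p ↦ lim_{t → ∞} (d(p, c(t)) - t)` for a unit-speed ray `c` with endpoint `ξ`. -/
def IsBusemann (ξ : VisualBoundary d 𝕜) (b : SymSpace d 𝕜 → ℝ) : Prop :=
  ∃ c : GeodesicRay d 𝕜, c.endpoint = ξ ∧ ∃ C : ℝ, ∀ p,
    Filter.Tendsto (fun t => riemDist p (c.toFun t) - t) Filter.atTop (𝓝 (b p + C))

end Boundary

end SymSpace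

/-!
A line–hyperplane flag `(ℓ ⊂ H)` is given by a vector `w` spanning `ℓ` and a vector `u ⊥ w` such
that `H` is the kernel of `u†`. The corresponding Busemann function is explicit: up to a constant
it is `b(p) = ½ (log (w† p⁻¹ w) + log (u† p u))` (`tendsto_riemDist_sub`). On the one hand this
function is `1`-Lipschitz (`half_log_sub_le_riemDist`), because in an orthonormal frame at `p` its
differential is the Frobenius pairing with a Hermitian matrix built from two orthogonal rank-one
projections (`sq_add_sq_le_trace_sq`); evaluated along the ray `c` this gives
`d(p, c(t)) - t ≥ b(p)`. On the other hand `d(p, c(t))` is at most the length of a flat segment,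
which is read off from the eigenvalues of `c(t)` relative to `p`. The trace and the sum of the
`2 × 2` principal minors show that only the largest and the smallest of these eigenvalues are
unbounded, and bound those two sharply (`exists_riemDist_le`).

Every geodesic ray is of the form `g exp(tA).I_d` (`GeodesicRay.exists_eq_standardRay`), since
`c⁻¹ c'` is constant by the geodesic equation. As `log (v† p⁻¹ v)` and `log (v† p v)` are Lipschitz,
their growth rates depend only on the endpoint of the ray. They recover the extreme entries of `A`
and, if `a₁ > a₂`, the line `g [e₁]`; in general a line `τ` in whose star the endpoint lies is
supported, in the coordinates of `g`, on those `i` with `a_i = a₁` (`eq_fst_of_mem_span`). In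
particular the flags in the star of `τ` are exactly those whose line is `τ`.

Now let `x = g.I_d` and `y = g exp(sA).I_d`, and let `v` and `f` be the coordinates of `w ∈ τ` and of
`u` in the frame `g`. Then `b(x) - b(y) = s a₁ - ½ log (∑ e^{2 s a_i} |f_i|² / ∑ |f_i|²)`. As `f`
annihilates `v`, it has no component of exponent larger than `a₂` (`le_snd_of_orthogonal`), whence
`b(x) - b(y) ≥ s (a₁ - a₂)`. Equality holds for a form supported on the exponent `a₂`, which exists
by `exists_orthogonal_of_support`.
-/

namespace SymSpace

/-! ### Hermitian forms and a Bessel inequality for matrices -/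

section HermitianForm

variable {d : ℕ} {𝕜 : Type*} [RCLike 𝕜]

/-- The value `v† q v` of the sesquilinear form with matrix `q`. Taking the real part loses
nothing when `q` is Hermitian, and makes the value a real number. -/
noncomputable def hermQuad (q : Matrix (Fin d) (Fin d) 𝕜) (v : Fin d → 𝕜) : ℝ :=
  RCLike.re (Star.star v ⬝ᵥ q *ᵥ v)

theorem hermQuad_conj (h Y : Matrix (Fin d) (Fin d) 𝕜) (v : Fin d → 𝕜) :
    hermQuad (h * Y * hᴴ) v = hermQuad Y (hᴴ *ᵥ v) := by
  simp only [hermQuad, Matrix.star_mulVec, Matrix.conjTranspose_conjTranspose,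
    Matrix.dotProduct_mulVec, Matrix.vecMul_vecMul, Matrix.mul_assoc]

theorem hermQuad_diagonal (e : Fin d → ℝ) (v : Fin d → 𝕜) :
    hermQuad (Matrix.diagonal fun i => ((e i : ℝ) : 𝕜)) v = ∑ i, e i * ‖v i‖ ^ 2 := by
  simp only [hermQuad, dotProduct, Matrix.mulVec_diagonal, map_sum, Pi.star_apply]
  refine Finset.sum_congr rfl fun i _ => ?_
  rw [mul_left_comm, RCLike.re_ofReal_mul, RCLike.star_def, RCLike.conj_mul]
  norm_cast

theorem hermQuad_one (v : Fin d → 𝕜) : hermQuad 1 v = ∑ i, ‖v i‖ ^ 2 := by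
  have := hermQuad_diagonal (fun _ => 1) v
  simpa using this

theorem hermQuad_conj_diagonal (h : Matrix (Fin d) (Fin d) 𝕜) (e : Fin d → ℝ) (v : Fin d → 𝕜) :
    hermQuad (h * Matrix.diagonal (fun i => ((e i : ℝ) : 𝕜)) * hᴴ) v =
      ∑ i, e i * ‖(hᴴ *ᵥ v) i‖ ^ 2 := by
  rw [hermQuad_conj, hermQuad_diagonal]

theorem hermQuad_zero (q : Matrix (Fin d) (Fin d) 𝕜) : hermQuad q 0 = 0 := by
  simp [hermQuad]

theorem hermQuad_pos {q : Matrix (Fin d) (Fin d) 𝕜} (hq : q.PosDef) {v : Fin d → 𝕜}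
    (hv : v ≠ 0) : 0 < hermQuad q v := by
  have := hq.dotProduct_mulVec_pos hv
  exact (RCLike.pos_iff.1 this).1

theorem hermQuad_eq_trace (q : Matrix (Fin d) (Fin d) 𝕜) (v : Fin d → 𝕜) :
    hermQuad q v = RCLike.re (Matrix.trace (q * Matrix.vecMulVec v (Star.star v))) := by
  rw [hermQuad, Matrix.mul_vecMulVec, Matrix.trace_vecMulVec, dotProduct_comm]

theorem trace_vecMulVec_mul (u w : Fin d → 𝕜) :
    Matrix.trace (Matrix.vecMulVec u (Star.star u) * Matrix.vecMulVec w (Star.star w)) =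
      (Star.star u ⬝ᵥ w) * Star.star (Star.star u ⬝ᵥ w) := by
  rw [Matrix.vecMulVec_mul_vecMulVec, Matrix.trace_vecMulVec, dotProduct_smul, smul_eq_mul,
    ← Matrix.star_dotProduct_star, star_star, dotProduct_comm (Star.star w)]

theorem star_dotProduct_self (w : Fin d → 𝕜) :
    Star.star w ⬝ᵥ w = ((hermQuad 1 w : ℝ) : 𝕜) := by
  rw [hermQuad_one, RCLike.ofReal_sum]
  refine Finset.sum_congr rfl fun i _ => ?_
  rw [Pi.star_apply, RCLike.star_def, RCLike.conj_mul]
  norm_cast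

/-- Bessel's inequality for the Frobenius inner product: a Hermitian matrix `Y` is projected
onto the rank-one Hermitian matrices `w w†` and `u u†`, which are orthogonal when `u ⊥ w`.
A vanishing vector contributes `0 / 0 = 0`. -/
theorem sq_add_sq_le_trace_sq {Y : Matrix (Fin d) (Fin d) 𝕜} (hY : Y.IsHermitian)
    {u w : Fin d → 𝕜} (huw : Star.star u ⬝ᵥ w = 0) :
    (hermQuad Y w / hermQuad 1 w) ^ 2 + (hermQuad Y u / hermQuad 1 u) ^ 2 ≤
      RCLike.re (Matrix.trace (Y * Y)) := by
  set x := hermQuad Y w / hermQuad 1 w ^ 2 with hx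
  set y := hermQuad Y u / hermQuad 1 u ^ 2 with hy
  set P := Matrix.vecMulVec w (Star.star w) with hP
  set R := Matrix.vecMulVec u (Star.star u) with hR
  have hPH : Pᴴ = P := by simp [hP]
  have hRH : Rᴴ = R := by simp [hR]
  set M := Y - (x : 𝕜) • P - (y : 𝕜) • R with hM
  have hMH : Mᴴ = M := by
    simp [hM, hPH, hRH, hY.eq, Matrix.conjTranspose_smul]
  have h0 : 0 ≤ RCLike.re (Matrix.trace (M * M)) := by
    have h1 : 0 ≤ Matrix.trace (Mᴴ * M) :=
      (Matrix.posSemidef_conjTranspose_mul_self M).trace_nonneg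
    rw [hMH] at h1
    exact (RCLike.nonneg_iff.1 h1).1
  have hPP : Matrix.trace (P * P) = (((hermQuad 1 w) ^ 2 : ℝ) : 𝕜) := by
    rw [hP, trace_vecMulVec_mul, star_dotProduct_self, RCLike.star_def, RCLike.conj_ofReal]
    push_cast; ring
  have hRR : Matrix.trace (R * R) = (((hermQuad 1 u) ^ 2 : ℝ) : 𝕜) := by
    rw [hR, trace_vecMulVec_mul, star_dotProduct_self, RCLike.star_def, RCLike.conj_ofReal]
    push_cast; ring
  have hRP : Matrix.trace (R * P) = 0 := by
    rw [hR, hP, trace_vecMulVec_mul, huw, zero_mul]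
  have hYP : RCLike.re (Matrix.trace (Y * P)) = hermQuad Y w := (hermQuad_eq_trace Y w).symm
  have hYR : RCLike.re (Matrix.trace (Y * R)) = hermQuad Y u := (hermQuad_eq_trace Y u).symm
  have hexp : Matrix.trace (M * M) = Matrix.trace (Y * Y) - (x : 𝕜) * (2 * Matrix.trace (Y * P))
      - (y : 𝕜) * (2 * Matrix.trace (Y * R)) + (x : 𝕜) * ((x : 𝕜) * Matrix.trace (P * P))
      + (y : 𝕜) * ((y : 𝕜) * Matrix.trace (R * R))
      + 2 * (x : 𝕜) * (y : 𝕜) * Matrix.trace (R * P) := by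
    simp only [hM, Matrix.sub_mul, Matrix.mul_sub, Matrix.smul_mul, Matrix.mul_smul,
      Matrix.trace_sub, Matrix.trace_smul, smul_eq_mul, Matrix.trace_mul_comm P Y,
      Matrix.trace_mul_comm R Y, Matrix.trace_mul_comm P R]
    ring
  have htwo : ∀ z : 𝕜, RCLike.re (2 * z) = 2 * RCLike.re z := by
    intro z
    rw [two_mul, map_add]; ring
  rw [hexp, hRP, hPP, hRR] at h0
  simp only [map_add, map_sub, RCLike.re_ofReal_mul, htwo, hYP, hYR, RCLike.ofReal_re, mul_zero,
    add_zero] at h0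
  have aux : ∀ q n : ℝ, q / n ^ 2 * (2 * q) - q / n ^ 2 * (q / n ^ 2 * n ^ 2) = (q / n) ^ 2 := by
    intro q n
    by_cases hn : n = 0
    · simp [hn]
    · field_simp; ring
  have h1 := aux (hermQuad Y w) (hermQuad 1 w)
  have h2 := aux (hermQuad Y u) (hermQuad 1 u)
  rw [← hx] at h1
  rw [← hy] at h2
  linarith

end HermitianForm

/-! ### The Riemannian norm in a frame -/

section TangentNorm

variable {d : ℕ} {𝕜 : Type*} [RCLike 𝕜]

theorem isUnit_det (g : Matrix.SpecialLinearGroup (Fin d) 𝕜) : IsUnit g.1.det := by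
  rw [g.2]; exact isUnit_one

theorem isUnit_det_conjTranspose (g : Matrix.SpecialLinearGroup (Fin d) 𝕜) :
    IsUnit g.1ᴴ.det := by
  rw [Matrix.det_conjTranspose, g.2]; simp

/-- `SL(d,𝕜)` acts transitively on the symmetric space. -/
theorem exists_eq_mul_conjTranspose [d.AtLeastTwo] (p : SymSpace d 𝕜) :
    ∃ h : Matrix.SpecialLinearGroup (Fin d) 𝕜, p.1 = h.1 * h.1ᴴ := by
  obtain ⟨a, -, -, g, hx, -⟩ := exists_isVectorDist p p
  exact ⟨g, by rw [hx, smul_base_val]⟩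

theorem inv_mul_conjTranspose (h : Matrix.SpecialLinearGroup (Fin d) 𝕜) :
    (h.1 * h.1ᴴ)⁻¹ = (h.1ᴴ)⁻¹ * h.1⁻¹ := Matrix.mul_inv_rev _ _

theorem inv_conjTranspose_eq (h : Matrix.SpecialLinearGroup (Fin d) 𝕜) :
    (h.1ᴴ)⁻¹ = (h.1⁻¹)ᴴ := (Matrix.conjTranspose_nonsing_inv _).symm

/-- In the frame `h`, the Riemannian norm at `h h†` is the Frobenius norm up to the factor
`1/√2`. -/
theorem tangentNorm_conj {p : SymSpace d 𝕜} {h : Matrix.SpecialLinearGroup (Fin d) 𝕜}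
    (hp : p.1 = h.1 * h.1ᴴ) (Y : Matrix (Fin d) (Fin d) 𝕜) :
    tangentNorm p (h.1 * Y * h.1ᴴ) = √(RCLike.re (Matrix.trace (Y * Y)) / 2) := by
  have h1 : p.1⁻¹ * (h.1 * Y * h.1ᴴ) = (h.1ᴴ)⁻¹ * (Y * h.1ᴴ) := by
    rw [hp, inv_mul_conjTranspose]
    simp only [Matrix.mul_assoc]
    rw [Matrix.nonsing_inv_mul_cancel_left _ _ (isUnit_det h)]
  rw [tangentNorm, Matrix.mul_assoc, h1]
  congr 3
  calc Matrix.trace ((h.1ᴴ)⁻¹ * (Y * h.1ᴴ) * ((h.1ᴴ)⁻¹ * (Y * h.1ᴴ)))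
      = Matrix.trace ((h.1ᴴ)⁻¹ * (Y * (h.1ᴴ * (h.1ᴴ)⁻¹) * (Y * h.1ᴴ))) := by
        simp only [Matrix.mul_assoc]
    _ = _ := by
      rw [Matrix.mul_nonsing_inv _ (isUnit_det_conjTranspose h), Matrix.mul_one,
        Matrix.trace_mul_comm, ← Matrix.mul_assoc, Matrix.mul_assoc,
        Matrix.mul_nonsing_inv _ (isUnit_det_conjTranspose h), Matrix.mul_one]

/-- The pointwise estimate behind the Lipschitz bound: the left side is the derivative of
`α log (w† p⁻¹ w) + β log (u† p u)` in the direction `X`. -/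
theorem directionalDerivative_le [d.AtLeastTwo] (p : SymSpace d 𝕜) {X : Matrix (Fin d) (Fin d) 𝕜}
    (hX : X.IsHermitian) {u w : Fin d → 𝕜} (huw : Star.star u ⬝ᵥ w = 0) (α β : ℝ) :
    α * (hermQuad (-(p.1⁻¹ * X * p.1⁻¹)) w / hermQuad p.1⁻¹ w) +
        β * (hermQuad X u / hermQuad p.1 u) ≤
      √(2 * (α ^ 2 + β ^ 2)) * tangentNorm p X := by
  obtain ⟨h, hp⟩ := exists_eq_mul_conjTranspose p
  set Y := h.1⁻¹ * X * (h.1⁻¹)ᴴ with hYdef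
  have hYH : Y.IsHermitian := Matrix.isHermitian_mul_mul_conjTranspose _ hX
  have hXY : X = h.1 * Y * h.1ᴴ := by
    rw [hYdef, ← inv_conjTranspose_eq]
    simp only [Matrix.mul_assoc]
    rw [Matrix.nonsing_inv_mul _ (isUnit_det_conjTranspose h), Matrix.mul_one,
      Matrix.mul_nonsing_inv_cancel_left _ _ (isUnit_det h)]
  have hpinv : p.1⁻¹ = (h.1⁻¹)ᴴ * ((h.1⁻¹)ᴴ)ᴴ := by
    rw [hp, inv_mul_conjTranspose, inv_conjTranspose_eq, Matrix.conjTranspose_conjTranspose]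
  set w' := h.1⁻¹ *ᵥ w with hw'
  set u' := h.1ᴴ *ᵥ u with hu'
  have horth : Star.star u' ⬝ᵥ w' = 0 := by
    rw [hu', hw', Matrix.star_mulVec, Matrix.conjTranspose_conjTranspose,
      ← Matrix.dotProduct_mulVec, Matrix.mulVec_mulVec, Matrix.mul_nonsing_inv _ (isUnit_det h),
      Matrix.one_mulVec, huw]
  have e1 : hermQuad (-(p.1⁻¹ * X * p.1⁻¹)) w = -hermQuad Y w' := by
    have : p.1⁻¹ * X * p.1⁻¹ = (h.1⁻¹)ᴴ * Y * ((h.1⁻¹)ᴴ)ᴴ := by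
      rw [hpinv, hYdef]
      simp only [Matrix.mul_assoc, Matrix.conjTranspose_conjTranspose]
    rw [this]
    rw [← neg_eq_iff_eq_neg, hw']
    have h2 := hermQuad_conj ((h.1⁻¹)ᴴ) Y w
    rw [Matrix.conjTranspose_conjTranspose] at h2 ⊢
    rw [← h2]
    simp [hermQuad, Matrix.neg_mulVec]
  have e2 : hermQuad p.1⁻¹ w = hermQuad 1 w' := by
    have h2 := hermQuad_conj ((h.1⁻¹)ᴴ) 1 w
    rw [Matrix.mul_one, ← hpinv, Matrix.conjTranspose_conjTranspose] at h2
    exact h2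
  have e3 : hermQuad X u = hermQuad Y u' := by rw [hXY, hermQuad_conj]
  have e4 : hermQuad p.1 u = hermQuad 1 u' := by
    have h2 := hermQuad_conj h.1 1 u
    rwa [Matrix.mul_one, ← hp] at h2
  rw [e1, e2, e3, e4]
  have hn : tangentNorm p X = √(RCLike.re (Matrix.trace (Y * Y)) / 2) := by
    rw [hXY]; exact tangentNorm_conj hp Y
  have hb := sq_add_sq_le_trace_sq hYH horth
  rw [hn, ← Real.sqrt_mul (by positivity)]
  apply Real.le_sqrt_of_sq_le
  rw [neg_div]
  set s := hermQuad Y w' / hermQuad 1 w'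
  set r := hermQuad Y u' / hermQuad 1 u'
  have hαβ : 0 ≤ α ^ 2 + β ^ 2 := by positivity
  have := mul_le_mul_of_nonneg_left hb hαβ
  nlinarith [sq_nonneg (α * r + β * s)]

end TangentNorm

/-! ### Calculus of curves of positive definite matrices -/

section MatrixCurves

variable {d : ℕ} {𝕜 : Type*} [RCLike 𝕜]

/-- The Leibniz rule for products of matrix-valued curves, entrywise. -/
theorem hasDerivAt_matrix_mul {M N : ℝ → Matrix (Fin d) (Fin d) 𝕜}
    {M' N' : Matrix (Fin d) (Fin d) 𝕜} {t : ℝ}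
    (hM : ∀ i j, HasDerivAt (fun s => M s i j) (M' i j) t)
    (hN : ∀ i j, HasDerivAt (fun s => N s i j) (N' i j) t) (i j : Fin d) :
    HasDerivAt (fun s => (M s * N s) i j) ((M' * N t + M t * N') i j) t := by
  simp only [Matrix.mul_apply, Matrix.add_apply, ← Finset.sum_add_distrib]
  exact HasDerivAt.fun_sum fun k _ => (hM i k).mul (hN k j)

theorem hasDerivAt_const_matrix (M : Matrix (Fin d) (Fin d) 𝕜) (t : ℝ) (i j : Fin d) :
    HasDerivAt (fun _ : ℝ => M i j) ((0 : Matrix (Fin d) (Fin d) 𝕜) i j) t :=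
  hasDerivAt_const t _

theorem hasDerivAt_hermQuad {M : ℝ → Matrix (Fin d) (Fin d) 𝕜}
    {M' : Matrix (Fin d) (Fin d) 𝕜} {t : ℝ}
    (hM : ∀ i j, HasDerivAt (fun s => M s i j) (M' i j) t) (v : Fin d → 𝕜) :
    HasDerivAt (fun s => hermQuad (M s) v) (hermQuad M' v) t := by
  have h : HasDerivAt (fun s => Star.star v ⬝ᵥ M s *ᵥ v) (Star.star v ⬝ᵥ M' *ᵥ v) t := by
    simp only [dotProduct, Matrix.mulVec]
    exact HasDerivAt.fun_sum fun i _ => HasDerivAt.const_mul _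
      (HasDerivAt.fun_sum fun j _ => (hM i j).mul_const _)
  exact (RCLike.reCLM (K := 𝕜)).hasFDerivAt.comp_hasDerivAt t h

theorem hasDerivAt_log_hermQuad {M : ℝ → Matrix (Fin d) (Fin d) 𝕜}
    {M' : Matrix (Fin d) (Fin d) 𝕜} {t : ℝ} (hpos : (M t).PosDef)
    (hM : ∀ i j, HasDerivAt (fun s => M s i j) (M' i j) t) (v : Fin d → 𝕜) :
    HasDerivAt (fun s => Real.log (hermQuad (M s) v))
      (hermQuad M' v / hermQuad (M t) v) t := by
  by_cases hv : v = 0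
  · subst hv
    simpa only [hermQuad_zero, Real.log_zero, zero_div] using hasDerivAt_const t (0 : ℝ)
  · exact (hasDerivAt_hermQuad hM v).log (hermQuad_pos hpos hv).ne'

theorem inv_eq_adjugate (p : SymSpace d 𝕜) : p.1⁻¹ = p.1.adjugate := by
  rw [Matrix.inv_def, p.2.2]; simp

theorem contDiff_det {n : WithTop ℕ∞} {M : ℝ → Matrix (Fin d) (Fin d) 𝕜}
    (hM : ∀ i j, ContDiff ℝ n fun t => M t i j) : ContDiff ℝ n fun t => (M t).det := by
  simp only [Matrix.det_apply]
  exact ContDiff.sum fun σ _ => (contDiff_prod fun i _ => hM _ _).const_smul _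

theorem contDiff_inv {n : WithTop ℕ∞} {γ : ℝ → SymSpace d 𝕜}
    (hγ : ∀ i j, ContDiff ℝ n fun t => (γ t).1 i j) (i j : Fin d) :
    ContDiff ℝ n fun t => (γ t).1⁻¹ i j := by
  simp only [inv_eq_adjugate, Matrix.adjugate_apply]
  refine contDiff_det fun k l => ?_
  by_cases hk : k = j
  · subst hk
    simp only [Matrix.updateRow_self]
    exact contDiff_const
  · simp only [Matrix.updateRow_ne hk]
    exact hγ k l

theorem hasDerivAt_velocity {M : ℝ → Matrix (Fin d) (Fin d) 𝕜} {n : WithTop ℕ∞} (hn : n ≠ 0)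
    (hM : ∀ i j, ContDiff ℝ n fun t => M t i j) (t : ℝ) (i j : Fin d) :
    HasDerivAt (fun s => M s i j) (velocity M t i j) t :=
  ((hM i j).differentiable hn t).hasDerivAt

theorem continuous_velocity {M : ℝ → Matrix (Fin d) (Fin d) 𝕜}
    (hM : ∀ i j, ContDiff ℝ 1 fun t => M t i j) : Continuous (velocity M) :=
  continuous_matrix fun i j => (hM i j).continuous_deriv le_rfl

theorem inv_mul_self (p : SymSpace d 𝕜) : p.1⁻¹ * p.1 = 1 :=
  Matrix.nonsing_inv_mul _ (by rw [p.2.2]; exact isUnit_one)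

theorem mul_inv_self (p : SymSpace d 𝕜) : p.1 * p.1⁻¹ = 1 :=
  Matrix.mul_nonsing_inv _ (by rw [p.2.2]; exact isUnit_one)

theorem hasDerivAt_inv {n : WithTop ℕ∞} (hn : n ≠ 0) {γ : ℝ → SymSpace d 𝕜}
    (hγ : ∀ i j, ContDiff ℝ n fun t => (γ t).1 i j) (t : ℝ) (i j : Fin d) :
    HasDerivAt (fun s => (γ s).1⁻¹ i j)
      ((-((γ t).1⁻¹ * velocity (fun s => (γ s).1) t * (γ t).1⁻¹)) i j) t := by
  have hi := hasDerivAt_velocity hn (contDiff_inv hγ) t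
  have hm := hasDerivAt_matrix_mul hi (hasDerivAt_velocity hn hγ t)
  have h0 : velocity (fun s => (γ s).1⁻¹) t * (γ t).1 +
      (γ t).1⁻¹ * velocity (fun s => (γ s).1) t = 0 := by
    ext k l
    refine (hm k l).unique ?_
    simp only [inv_mul_self]
    exact hasDerivAt_const_matrix 1 t k l
  have h1 : velocity (fun s => (γ s).1⁻¹) t =
      -((γ t).1⁻¹ * velocity (fun s => (γ s).1) t * (γ t).1⁻¹) := by
    have h2 := congrArg (· * (γ t).1⁻¹) (eq_neg_of_add_eq_zero_left h0)
    simp only [Matrix.mul_assoc, mul_inv_self, Matrix.mul_one, Matrix.neg_mul] at h2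
    rw [h2]
    simp only [Matrix.mul_assoc]
  rw [← h1]
  exact hi i j

theorem isHermitian_velocity {γ : ℝ → SymSpace d 𝕜}
    (hγ : ∀ i j, ContDiff ℝ 1 fun t => (γ t).1 i j) (t : ℝ) :
    (velocity (fun s => (γ s).1) t).IsHermitian := by
  ext i j
  rw [Matrix.conjTranspose_apply]
  have h1 := hasDerivAt_velocity one_ne_zero hγ t j i
  have h2 := (RCLike.conjCLE (K := 𝕜)).toContinuousLinearMap.hasFDerivAt.comp_hasDerivAt t h1
  refine h2.unique ?_
  have h3 : (⇑(RCLike.conjCLE (K := 𝕜)).toContinuousLinearMap ∘ fun s => (γ s).1 j i) =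
      fun s => (γ s).1 i j := by
    funext s
    exact (γ s).2.1.isHermitian.apply i j
  rw [h3]
  exact hasDerivAt_velocity one_ne_zero hγ t i j

theorem continuous_tangentNorm {γ : ℝ → SymSpace d 𝕜}
    (hγ : ∀ i j, ContDiff ℝ 1 fun t => (γ t).1 i j) :
    Continuous fun t => tangentNorm (γ t) (velocity (fun s => (γ s).1) t) := by
  have h1 : Continuous fun t => (γ t).1⁻¹ :=
    continuous_matrix fun i j => (contDiff_inv hγ i j).continuous
  have h2 := continuous_velocity hγ
  unfold tangentNorm
  exact ((RCLike.continuous_re.comp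
    (((h1.mul h2).mul h1).mul h2).matrix_trace).div_const 2).sqrt

end MatrixCurves

/-! ### Lipschitz bounds for logarithms of Hermitian forms -/

section Lipschitz

variable {d : ℕ} {𝕜 : Type*} [RCLike 𝕜] [d.AtLeastTwo]

/-- For `u ⊥ w` the function `α log (w† p⁻¹ w) + β log (u† p u)` is Lipschitz with constant
`√(2 (α² + β²))`. Either vector may vanish, in which case its logarithm is the constant `0`. -/
theorem sub_le_mul_riemDist {u w : Fin d → 𝕜} (huw : Star.star u ⬝ᵥ w = 0) (α β : ℝ)
    (x y : SymSpace d 𝕜) :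
    (α * Real.log (hermQuad y.1⁻¹ w) + β * Real.log (hermQuad y.1 u)) -
      (α * Real.log (hermQuad x.1⁻¹ w) + β * Real.log (hermQuad x.1 u)) ≤
      √(2 * (α ^ 2 + β ^ 2)) * riemDist x y := by
  have key : ∀ {x y : SymSpace d 𝕜} {L : ℝ}, JoinedByLength x y L →
      (α * Real.log (hermQuad y.1⁻¹ w) + β * Real.log (hermQuad y.1 u)) -
      (α * Real.log (hermQuad x.1⁻¹ w) + β * Real.log (hermQuad x.1 u)) ≤
      √(2 * (α ^ 2 + β ^ 2)) * L := by
    intro x y L h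
    induction h with
    | path γ hγ =>
      have hd : ∀ t, HasDerivAt (fun s => α * Real.log (hermQuad (γ s).1⁻¹ w) +
          β * Real.log (hermQuad (γ s).1 u))
          (α * (hermQuad (-((γ t).1⁻¹ * velocity (fun s => (γ s).1) t * (γ t).1⁻¹)) w /
            hermQuad (γ t).1⁻¹ w) +
          β * (hermQuad (velocity (fun s => (γ s).1) t) u / hermQuad (γ t).1 u)) t := fun t =>
        ((hasDerivAt_log_hermQuad (γ t).2.1.inv (hasDerivAt_inv one_ne_zero hγ t) w).const_mul
          α).add ((hasDerivAt_log_hermQuad (γ t).2.1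
          (hasDerivAt_velocity one_ne_zero hγ t) u).const_mul β)
      have hc : Continuous fun t => √(2 * (α ^ 2 + β ^ 2)) *
          tangentNorm (γ t) (velocity (fun s => (γ s).1) t) :=
        continuous_const.mul (continuous_tangentNorm hγ)
      have := intervalIntegral.sub_le_integral_of_hasDeriv_right_of_le zero_le_one
        (fun t _ => (hd t).continuousAt.continuousWithinAt)
        (fun t _ => (hd t).hasDerivWithinAt) hc.continuousOn.integrableOn_Icc
        (fun t _ => directionalDerivative_le (γ t) (isHermitian_velocity hγ t) huw α β)
      rwa [intervalIntegral.integral_const_mul] at this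
    | concat _ _ h1 h2 => rw [mul_add]; linarith
  rcases (Real.sqrt_nonneg (2 * (α ^ 2 + β ^ 2))).eq_or_lt with h0 | h0
  · obtain ⟨L, hL⟩ := exists_joinedByLength x y
    have := key hL
    rw [← h0, zero_mul] at this ⊢
    exact this
  · rw [← div_le_iff₀' h0]
    refine le_csInf (exists_joinedByLength x y) fun L hL => ?_
    rw [div_le_iff₀' h0]
    exact key hL

theorem abs_log_hermQuad_sub_le (v : Fin d → 𝕜) (x y : SymSpace d 𝕜) :
    |Real.log (hermQuad y.1 v) - Real.log (hermQuad x.1 v)| ≤ √2 * riemDist x y := by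
  have h1 := sub_le_mul_riemDist (u := v) (w := 0) (dotProduct_zero _) 0 1 x y
  have h2 := sub_le_mul_riemDist (u := v) (w := 0) (dotProduct_zero _) 0 (-1) x y
  norm_num at h1 h2
  rw [abs_le]
  constructor <;> linarith

theorem abs_log_hermQuad_inv_sub_le (v : Fin d → 𝕜) (x y : SymSpace d 𝕜) :
    |Real.log (hermQuad y.1⁻¹ v) - Real.log (hermQuad x.1⁻¹ v)| ≤ √2 * riemDist x y := by
  have h0 : Star.star (0 : Fin d → 𝕜) ⬝ᵥ v = 0 := by simp
  have h1 := sub_le_mul_riemDist h0 1 0 x y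
  have h2 := sub_le_mul_riemDist h0 (-1) 0 x y
  norm_num at h1 h2
  rw [abs_le]
  constructor <;> linarith

/-- `½ (log (w† p⁻¹ w) + log (u† p u))` is `1`-Lipschitz. -/
theorem half_log_sub_le_riemDist {u w : Fin d → 𝕜} (huw : Star.star u ⬝ᵥ w = 0)
    (x y : SymSpace d 𝕜) :
    (Real.log (hermQuad x.1⁻¹ w) + Real.log (hermQuad x.1 u)) / 2 -
      (Real.log (hermQuad y.1⁻¹ w) + Real.log (hermQuad y.1 u)) / 2 ≤ riemDist x y := by
  have h := sub_le_mul_riemDist huw (1 / 2) (1 / 2) y x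
  norm_num at h
  rw [riemDist_comm x y]
  linarith

end Lipschitz

/-! ### Lengths of flat segments -/

section FlatCurves

variable {d : ℕ} {𝕜 : Type*} [RCLike 𝕜]

theorem velocity_flatCurve (g : Matrix.SpecialLinearGroup (Fin d) 𝕜) (a : Fin d → ℝ)
    (ha : ∑ i, a i = 0) (t : ℝ) :
    velocity (fun s => (flatCurve g a ha s).1) t = g.1 * Matrix.diagonal
      (fun i => ((2 * a i * Real.exp (2 * a i * t) : ℝ) : 𝕜)) * g.1ᴴ := by
  ext i j
  have := (hasDerivAt_flat g.1 (fun i => 2 * a i) (fun _ => 1) i j t).deriv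
  simpa only [velocity, Matrix.of_apply, flatCurve_val, one_mul] using this

theorem tangentNorm_flatCurve (g : Matrix.SpecialLinearGroup (Fin d) 𝕜) (a : Fin d → ℝ)
    (ha : ∑ i, a i = 0) (t : ℝ) :
    tangentNorm (flatCurve g a ha t) (velocity (fun s => (flatCurve g a ha s).1) t) =
      √(2 * ∑ i, a i ^ 2) := by
  set k : Matrix.SpecialLinearGroup (Fin d) 𝕜 :=
    g * expDiag 𝕜 (fun i => t * a i) (by rw [← Finset.mul_sum, ha, mul_zero]) with hk
  have hp : (flatCurve g a ha t).1 = k.1 * k.1ᴴ := by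
    rw [← smul_base_val, flatCurve, hk]
    simp [smul_val, Matrix.mul_assoc]
  have hv : velocity (fun s => (flatCurve g a ha s).1) t =
      k.1 * Matrix.diagonal (fun i => ((2 * a i : ℝ) : 𝕜)) * k.1ᴴ := by
    have hk1 : k.1 = g.1 * Matrix.diagonal (fun i => ((Real.exp (t * a i) : ℝ) : 𝕜)) := rfl
    rw [velocity_flatCurve, hk1, Matrix.conjTranspose_mul, Matrix.diagonal_conjTranspose]
    simp only [Matrix.mul_assoc]
    congr 1
    simp only [← Matrix.mul_assoc, Matrix.diagonal_mul_diagonal]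
    congr 2
    funext i
    simp only [Pi.star_apply, RCLike.star_def, RCLike.conj_ofReal, ← RCLike.ofReal_mul]
    congr 1
    have he : Real.exp (2 * a i * t) = Real.exp (t * a i) * Real.exp (t * a i) := by
      rw [← Real.exp_add]; ring_nf
    rw [he]
    ring
  rw [hv, tangentNorm_conj hp, Matrix.diagonal_mul_diagonal, Matrix.trace_diagonal]
  simp only [← RCLike.ofReal_mul]
  rw [← RCLike.ofReal_sum, RCLike.ofReal_re, Finset.mul_sum, Finset.sum_div]
  congr 2
  funext i
  ring

/-- The flat segment from `x` to `y` bounds their Riemannian distance. -/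
theorem IsVectorDist.riemDist_le {x y : SymSpace d 𝕜} {a : Fin d → ℝ}
    (h : IsVectorDist x y a) : riemDist x y ≤ √(2 * ∑ i, a i ^ 2) := by
  obtain ⟨-, ha, g, hx, hy⟩ := h
  have hj := JoinedByLength.path (flatCurve g a ha) (contDiff_flatCurve g a ha 1)
  have h0 : flatCurve g a ha 0 = x := by
    rw [hx]; apply Subtype.ext; rw [flatCurve_val, smul_base_val]; simp
  have h1 : flatCurve g a ha 1 = y := by
    rw [hy]; simp [flatCurve]
  have hL : pathLength (flatCurve g a ha) = √(2 * ∑ i, a i ^ 2) := by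
    simp [pathLength, tangentNorm_flatCurve]
  rw [h0, h1, hL] at hj
  exact csInf_le (bddBelow_joined x y) hj

end FlatCurves

/-! ### Classification of geodesic rays -/

section Geodesics

variable {d : ℕ} {𝕜 : Type*} [RCLike 𝕜]

/-- A Hermitian matrix is diagonalised by an element of `SU(d,𝕜)`, with sorted eigenvalues. The
positive definite unimodular case applies after adding a multiple of the identity and scaling. -/
theorem exists_spectral_of_isHermitian [d.AtLeastTwo] {S : Matrix (Fin d) (Fin d) 𝕜} (hS : S.IsHermitian) :
    ∃ (k : Matrix.SpecialLinearGroup (Fin d) 𝕜) (s : Fin d → ℝ), Antitone s ∧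
      k.1 * k.1ᴴ = 1 ∧ S = k.1 * Matrix.diagonal (fun i => ((s i : ℝ) : 𝕜)) * k.1ᴴ := by
  classical
  set ev := hS.eigenvalues
  set U : Matrix (Fin d) (Fin d) 𝕜 := hS.eigenvectorUnitary.1
  have hUU : U * Uᴴ = 1 := Unitary.coe_mul_star_self hS.eigenvectorUnitary
  have hSU : S = U * Matrix.diagonal (fun i => ((ev i : ℝ) : 𝕜)) * Uᴴ := by
    have := hS.spectral_theorem
    rw [Unitary.conjStarAlgAut_apply] at this
    exact this
  set l : ℝ := 1 + ∑ i, |ev i| with hl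
  have hpos : ∀ i, 0 < ev i + l := by
    intro i
    have h1 := Finset.single_le_sum (f := fun i => |ev i|) (fun j _ => abs_nonneg _)
      (Finset.mem_univ i)
    have h2 := neg_abs_le (ev i)
    linarith
  set q : Matrix (Fin d) (Fin d) 𝕜 := S + (l : 𝕜) • 1 with hq
  have hqU : q = U * Matrix.diagonal (fun i => ((ev i + l : ℝ) : 𝕜)) * Uᴴ := by
    have h1 : Matrix.diagonal (fun i => ((ev i + l : ℝ) : 𝕜)) =
        Matrix.diagonal (fun i => ((ev i : ℝ) : 𝕜)) + (l : 𝕜) • 1 := by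
      rw [← Matrix.diagonal_one, ← Matrix.diagonal_smul, Matrix.diagonal_add]
      congr 1; funext i; simp
    rw [h1, Matrix.mul_add, Matrix.add_mul, ← hSU]
    simp [hUU, hq]
  have hUunit : IsUnit U := IsUnit.of_mul_eq_one _ hUU
  have hqpos : q.PosDef := by
    rw [hqU]
    refine (Matrix.IsUnit.posDef_star_right_conjugate_iff hUunit).2 (Matrix.PosDef.diagonal ?_)
    intro i
    exact RCLike.ofReal_pos.2 (hpos i)
  obtain ⟨hD, hDim⟩ := RCLike.pos_iff.1 hqpos.det_pos
  set D : ℝ := RCLike.re q.det with hDdef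
  have hdet : q.det = (D : 𝕜) := by
    refine RCLike.ext ?_ ?_
    · simp [hDdef]
    · rw [hDim]; simp
  set r : ℝ := D ^ (-(1 / (d : ℝ))) with hr
  have hr0 : 0 < r := Real.rpow_pos_of_pos hD _
  have hd0 : (d : ℝ) ≠ 0 := by
    have : 2 ≤ d := Nat.AtLeastTwo.prop
    positivity
  have hrd : r ^ d * D = 1 := by
    rw [hr, ← Real.rpow_natCast, ← Real.rpow_mul hD.le, neg_mul, one_div_mul_cancel hd0,
      Real.rpow_neg_one, inv_mul_cancel₀ hD.ne']
  obtain ⟨k, a, ha, -, hk, hqk⟩ := exists_spectral ((r : 𝕜) • q)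
    (hqpos.smul (RCLike.ofReal_pos.2 hr0)) (by
      rw [Matrix.det_smul, hdet, Fintype.card_fin]
      exact_mod_cast congrArg (RCLike.ofReal (K := 𝕜)) hrd)
  refine ⟨k, fun i => Real.exp (2 * a i) / r - l, ?_, hk, ?_⟩
  · intro i j hij
    have := ha hij
    have h1 : Real.exp (2 * a j) ≤ Real.exp (2 * a i) := Real.exp_le_exp.2 (by linarith)
    have := div_le_div_of_nonneg_right h1 hr0.le
    simp only
    linarith
  · have h1 : Matrix.diagonal (fun i => ((Real.exp (2 * a i) / r - l : ℝ) : 𝕜)) =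
        (r : 𝕜)⁻¹ • Matrix.diagonal (fun i => ((Real.exp (2 * a i) : ℝ) : 𝕜)) - (l : 𝕜) • 1 := by
      rw [← Matrix.diagonal_one, ← Matrix.diagonal_smul, ← Matrix.diagonal_smul,
        Matrix.diagonal_sub]
      congr 1; funext i
      simp [div_eq_inv_mul]
    have hr' : (r : 𝕜) ≠ 0 := by exact_mod_cast hr0.ne'
    rw [h1, Matrix.mul_sub, Matrix.sub_mul, Matrix.mul_smul, Matrix.smul_mul, ← hqk,
      inv_smul_smul₀ hr', hq]
    simp [hk]

theorem GeodesicRay.ext {c c' : GeodesicRay d 𝕜} (h : ∀ t, c.toFun t = c'.toFun t) : c = c' := by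
  cases c; cases c'
  congr
  exact funext h

theorem standardRay_toFun (g : Matrix.SpecialLinearGroup (Fin d) 𝕜) (A : ModelChamber d) :
    (standardRay g A).toFun = flatCurve g A.1 A.2.2.1 := rfl

/-- The geodesic equation says that `c⁻¹ c'` is constant. -/
theorem GeodesicRay.inv_mul_velocity (c : GeodesicRay d 𝕜) (t : ℝ) :
    (c.toFun t).1⁻¹ * velocity (fun s => (c.toFun s).1) t =
      (c.toFun 0).1⁻¹ * velocity (fun s => (c.toFun s).1) 0 := by
  have hv : ∀ t i j, HasDerivAt (fun s => velocity (fun s => (c.toFun s).1) s i j)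
      (velocity (velocity fun s => (c.toFun s).1) t i j) t := by
    refine hasDerivAt_velocity (n := 1) one_ne_zero fun i j => ?_
    have h2 : ContDiff ℝ 2 fun t => (c.toFun t).1 i j := (c.contDiff i j).of_le
      (WithTop.coe_le_coe.2 (le_top : (2 : ℕ∞) ≤ ⊤))
    exact ((contDiff_succ_iff_deriv (n := 1)).1 h2).2.2
  ext i j
  refine is_const_of_deriv_eq_zero (𝕜 := ℝ)
    (f := fun t => ((c.toFun t).1⁻¹ * velocity (fun s => (c.toFun s).1) t) i j) ?_ ?_ t 0
  · exact fun t => (hasDerivAt_matrix_mul (hasDerivAt_inv (by simp) c.contDiff t)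
      (hv t) i j).differentiableAt
  · intro t
    rw [(hasDerivAt_matrix_mul (hasDerivAt_inv (by simp) c.contDiff t) (hv t) i j).deriv,
      c.geodesic t]
    simp [Matrix.mul_assoc]

/-- Every unit-speed geodesic ray has the form `t ↦ g exp(tA).I_d`. -/
theorem GeodesicRay.exists_eq_standardRay [d.AtLeastTwo] (c : GeodesicRay d 𝕜) :
    ∃ g A, c = standardRay g A := by
  have hc1 : ∀ i j, ContDiff ℝ 1 fun t => (c.toFun t).1 i j := fun i j =>
    (c.contDiff i j).of_le (by exact_mod_cast (le_top : (1 : ℕ∞) ≤ ⊤))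
  obtain ⟨g₀, hg₀⟩ := exists_eq_mul_conjTranspose (c.toFun 0)
  set X₀ := velocity (fun s => (c.toFun s).1) 0 with hX₀
  have hS : (g₀.1⁻¹ * X₀ * (g₀.1⁻¹)ᴴ).IsHermitian :=
    Matrix.isHermitian_mul_mul_conjTranspose _ (isHermitian_velocity hc1 0)
  obtain ⟨k, s, hs, hk, hSk⟩ := exists_spectral_of_isHermitian hS
  -- The frame `g` diagonalises the point `c 0` and the velocity of `c` there simultaneously.
  set g := g₀ * k with hg
  have hgval : g.1 = g₀.1 * k.1 := rfl
  have hp0 : (c.toFun 0).1 = g.1 * g.1ᴴ := by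
    rw [hg₀, hgval, Matrix.conjTranspose_mul]
    calc _ = g₀.1 * (k.1 * k.1ᴴ) * g₀.1ᴴ := by rw [hk, Matrix.mul_one]
      _ = _ := by simp only [Matrix.mul_assoc]
  have hv0 : X₀ = g.1 * Matrix.diagonal (fun i => ((s i : ℝ) : 𝕜)) * g.1ᴴ := by
    rw [hgval, Matrix.conjTranspose_mul]
    calc X₀ = (g₀.1 * g₀.1⁻¹) * X₀ * ((g₀.1⁻¹)ᴴ * g₀.1ᴴ) := by
          rw [← inv_conjTranspose_eq, Matrix.mul_nonsing_inv _ (isUnit_det g₀),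
            Matrix.nonsing_inv_mul _ (isUnit_det_conjTranspose g₀), Matrix.one_mul, Matrix.mul_one]
      _ = g₀.1 * (g₀.1⁻¹ * X₀ * (g₀.1⁻¹)ᴴ) * g₀.1ᴴ := by simp only [Matrix.mul_assoc]
      _ = _ := by rw [hSk]; simp only [Matrix.mul_assoc]
  have hM : (c.toFun 0).1⁻¹ * X₀ =
      (g.1ᴴ)⁻¹ * Matrix.diagonal (fun i => ((s i : ℝ) : 𝕜)) * g.1ᴴ := by
    rw [hp0, hv0, inv_mul_conjTranspose]
    simp only [Matrix.mul_assoc]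
    rw [Matrix.nonsing_inv_mul_cancel_left _ _ (isUnit_det g)]
  set N : ℝ → Matrix (Fin d) (Fin d) 𝕜 := fun t => g.1⁻¹ * (c.toFun t).1 * (g.1ᴴ)⁻¹ with hN
  have hNd : ∀ t i j, HasDerivAt (fun t => N t i j) (N t i j * (s j : 𝕜)) t := by
    intro t i j
    have h1 := hasDerivAt_matrix_mul (hasDerivAt_matrix_mul
      (hasDerivAt_const_matrix g.1⁻¹ t) (hasDerivAt_velocity one_ne_zero hc1 t))
      (hasDerivAt_const_matrix (g.1ᴴ)⁻¹ t) i j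
    have h2 : velocity (fun s => (c.toFun s).1) t =
        (c.toFun t).1 * ((g.1ᴴ)⁻¹ * Matrix.diagonal (fun i => ((s i : ℝ) : 𝕜)) * g.1ᴴ) := by
      rw [← hM, hX₀, ← c.inv_mul_velocity t, ← Matrix.mul_assoc, mul_inv_self, Matrix.one_mul]
    have h3 : g.1⁻¹ * velocity (fun s => (c.toFun s).1) t * (g.1ᴴ)⁻¹ =
        N t * Matrix.diagonal (fun i => ((s i : ℝ) : 𝕜)) := by
      rw [h2, hN]
      simp only [Matrix.mul_assoc]
      rw [Matrix.mul_nonsing_inv _ (isUnit_det_conjTranspose g), Matrix.mul_one]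
    simp only [Matrix.zero_mul, Matrix.mul_zero, zero_add, add_zero, h3,
      Matrix.mul_diagonal] at h1
    exact h1
  have hNe : ∀ t i j, N t i j = N 0 i j * ((Real.exp (s j * t) : ℝ) : 𝕜) := by
    intro t i j
    have he : ∀ t, HasDerivAt (fun t : ℝ => ((Real.exp (-(s j * t)) : ℝ) : 𝕜))
        (-((s j : ℝ) : 𝕜) * ((Real.exp (-(s j * t)) : ℝ) : 𝕜)) t := by
      intro t
      have h1 : HasDerivAt (fun t : ℝ => Real.exp (-(s j * t)))
          (-(s j) * Real.exp (-(s j * t))) t := by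
        have := (((hasDerivAt_id t).const_mul (s j)).neg).exp
        simpa [mul_comm] using this
      have h2 := (RCLike.ofRealCLM (K := 𝕜)).hasFDerivAt.comp_hasDerivAt t h1
      rw [RCLike.ofRealCLM_apply, RCLike.ofReal_mul, RCLike.ofReal_neg] at h2
      exact h2
    have h0 := is_const_of_deriv_eq_zero (𝕜 := ℝ)
      (f := fun t => N t i j * ((Real.exp (-(s j * t)) : ℝ) : 𝕜))
      (fun t => ((hNd t i j).mul (he t)).differentiableAt)
      (fun t => ((hNd t i j).mul (he t)).deriv.trans (by ring)) t 0
    simp only [mul_zero, neg_zero, Real.exp_zero, RCLike.ofReal_one, mul_one] at h0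
    rw [← h0, mul_assoc, ← RCLike.ofReal_mul, ← Real.exp_add]
    simp
  have hN0 : N 0 = 1 := by
    rw [hN]
    simp only
    rw [hp0, ← Matrix.mul_assoc, Matrix.nonsing_inv_mul _ (isUnit_det g), Matrix.one_mul,
      Matrix.mul_nonsing_inv _ (isUnit_det_conjTranspose g)]
  have hNdiag : ∀ t, N t = Matrix.diagonal (fun i => ((Real.exp (s i * t) : ℝ) : 𝕜)) := by
    intro t
    ext i j
    rw [hNe, hN0, Matrix.diagonal_apply, Matrix.one_apply]
    split_ifs with h
    · rw [h, one_mul]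
    · rw [zero_mul]
  have hcval : ∀ t, (c.toFun t).1 =
      g.1 * Matrix.diagonal (fun i => ((Real.exp (s i * t) : ℝ) : 𝕜)) * g.1ᴴ := by
    intro t
    rw [← hNdiag t, hN]
    simp only [Matrix.mul_assoc]
    rw [Matrix.nonsing_inv_mul _ (isUnit_det_conjTranspose g), Matrix.mul_one,
      Matrix.mul_nonsing_inv_cancel_left _ _ (isUnit_det g)]
  have hsum : ∑ i, s i = 0 := by
    have h1 := (c.toFun 1).2.2
    rw [hcval 1, Matrix.det_mul, Matrix.det_mul, Matrix.det_conjTranspose, g.2,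
      Matrix.det_diagonal, ← RCLike.ofReal_prod, ← Real.exp_sum] at h1
    simp only [one_mul, star_one, mul_one] at h1
    exact Real.exp_eq_one_iff _ |>.1 (by exact_mod_cast h1)
  have hunit : 2 * ∑ i, (s i / 2) ^ 2 = 1 := by
    have h1 := c.unit_speed 0
    rw [← hX₀, hv0, tangentNorm_conj hp0, Matrix.diagonal_mul_diagonal, Matrix.trace_diagonal]
      at h1
    simp only [← RCLike.ofReal_mul] at h1
    rw [← RCLike.ofReal_sum, RCLike.ofReal_re, Real.sqrt_eq_one] at h1
    rw [← h1, Finset.mul_sum, Finset.sum_div]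
    exact Finset.sum_congr rfl fun i _ => by ring
  have hsum' : ∑ i, s i / 2 = 0 := by rw [← Finset.sum_div, hsum, zero_div]
  refine ⟨g, ⟨fun i => s i / 2, fun i j hij => div_le_div_of_nonneg_right (hs hij) (by norm_num),
    hsum', hunit⟩, GeodesicRay.ext fun t => Subtype.ext ((hcval t).trans
      (Eq.trans ?_ (flatCurve_val g (fun i => s i / 2) hsum' t).symm))⟩
  congr 3
  funext i
  congr 2
  ring

end Geodesics

/-! ### Growth rates along asymptotic rays -/

section GrowthRates

variable {d : ℕ} {𝕜 : Type*} [RCLike 𝕜]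

theorem inv_conj_diagonal_exp (g : Matrix.SpecialLinearGroup (Fin d) 𝕜) (a : Fin d → ℝ) :
    (g.1 * Matrix.diagonal (fun i => ((Real.exp (a i) : ℝ) : 𝕜)) * g.1ᴴ)⁻¹ =
      (g.1⁻¹)ᴴ * Matrix.diagonal (fun i => ((Real.exp (-a i) : ℝ) : 𝕜)) * ((g.1⁻¹)ᴴ)ᴴ := by
  have hD : (Matrix.diagonal (fun i => ((Real.exp (a i) : ℝ) : 𝕜)))⁻¹ =
      Matrix.diagonal (fun i => ((Real.exp (-a i) : ℝ) : 𝕜)) := by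
    refine Matrix.inv_eq_left_inv ?_
    rw [Matrix.diagonal_mul_diagonal, ← Matrix.diagonal_one]
    congr 1; funext i
    rw [← RCLike.ofReal_mul, ← Real.exp_add]; simp
  rw [Matrix.mul_inv_rev, Matrix.mul_inv_rev, hD, inv_conjTranspose_eq,
    Matrix.conjTranspose_conjTranspose, Matrix.mul_assoc]

theorem hermQuad_flatCurve (g : Matrix.SpecialLinearGroup (Fin d) 𝕜) (a : Fin d → ℝ)
    (ha : ∑ i, a i = 0) (t : ℝ) (v : Fin d → 𝕜) :
    hermQuad (flatCurve g a ha t).1 v =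
      ∑ i, Real.exp (2 * a i * t) * ‖(g.1ᴴ *ᵥ v) i‖ ^ 2 := by
  rw [flatCurve_val, hermQuad_conj_diagonal]

theorem hermQuad_flatCurve_inv (g : Matrix.SpecialLinearGroup (Fin d) 𝕜) (a : Fin d → ℝ)
    (ha : ∑ i, a i = 0) (t : ℝ) (v : Fin d → 𝕜) :
    hermQuad (flatCurve g a ha t).1⁻¹ v =
      ∑ i, Real.exp (-(2 * a i * t)) * ‖(g.1⁻¹ *ᵥ v) i‖ ^ 2 := by
  rw [flatCurve_val, inv_conj_diagonal_exp, hermQuad_conj_diagonal,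
    Matrix.conjTranspose_conjTranspose]

/-- If two sums of exponentials with nonnegative coefficients stay at bounded ratio, an exponent
that occurs in the first is at most the largest exponent that occurs in the second. -/
theorem exponent_le_of_abs_log_sub_le {a b m n : Fin d → ℝ} {C β : ℝ} (hm : ∀ i, 0 ≤ m i)
    (hn : ∀ i, 0 ≤ n i) (hn0 : ∃ j, 0 < n j)
    (h : ∀ t, 0 ≤ t → |Real.log (∑ i, Real.exp (a i * t) * m i) -
      Real.log (∑ i, Real.exp (b i * t) * n i)| ≤ C)
    (hb : ∀ j, 0 < n j → b j ≤ β) {i : Fin d} (hi : 0 < m i) : a i ≤ β := by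
  by_contra! hlt
  obtain ⟨j, hj⟩ := hn0
  have hN : 0 < ∑ i, n i := Finset.sum_pos' (fun i _ => hn i) ⟨j, Finset.mem_univ _, hj⟩
  have key : ∀ t, 0 ≤ t → (a i - β) * t ≤ C + Real.log (∑ i, n i) - Real.log (m i) := by
    intro t ht
    have h1 : Real.log (m i) + a i * t ≤ Real.log (∑ i, Real.exp (a i * t) * m i) := by
      rw [← Real.log_exp (a i * t), add_comm, ← Real.log_mul (Real.exp_pos _).ne' hi.ne']
      refine Real.log_le_log (mul_pos (Real.exp_pos _) hi) ?_
      exact Finset.single_le_sum (f := fun i => Real.exp (a i * t) * m i)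
        (fun j _ => mul_nonneg (Real.exp_pos _).le (hm j)) (Finset.mem_univ i)
    have h2 : Real.log (∑ i, Real.exp (b i * t) * n i) ≤ Real.log (∑ i, n i) + β * t := by
      rw [← Real.log_exp (β * t), add_comm, ← Real.log_mul (Real.exp_pos _).ne' hN.ne',
        Finset.mul_sum]
      refine Real.log_le_log (Finset.sum_pos' (fun k _ => mul_nonneg (Real.exp_pos _).le (hn k))
        ⟨j, Finset.mem_univ _, mul_pos (Real.exp_pos _) hj⟩) (Finset.sum_le_sum fun k _ => ?_)
      rcases (hn k).eq_or_lt with h0 | h0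
      · simp [← h0]
      · exact mul_le_mul_of_nonneg_right
          (Real.exp_le_exp.2 (mul_le_mul_of_nonneg_right (hb k h0) ht)) h0.le
    have h3 := (abs_le.1 (h t ht)).2
    linarith
  have h0 : 0 < a i - β := sub_pos.2 hlt
  set D := C + Real.log (∑ i, n i) - Real.log (m i) with hD
  have := key ((|D| + 1) / (a i - β)) (by positivity)
  rw [mul_div_cancel₀ _ h0.ne'] at this
  linarith [le_abs_self D]

theorem mulVec_ne_zero {g : Matrix (Fin d) (Fin d) 𝕜} (hg : IsUnit g.det) {v : Fin d → 𝕜}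
    (hv : v ≠ 0) : ∃ i, (g *ᵥ v) i ≠ 0 := by
  by_contra! h
  apply hv
  have h1 : g *ᵥ v = 0 := funext h
  have h2 := congrArg (g⁻¹ *ᵥ ·) h1
  simpa [Matrix.mulVec_mulVec, Matrix.nonsing_inv_mul _ hg] using h2

theorem isUnit_det_inv (g : Matrix.SpecialLinearGroup (Fin d) 𝕜) : IsUnit (g.1⁻¹).det :=
  Matrix.isUnit_nonsing_inv_det _ (isUnit_det g)

theorem conjTranspose_mulVec_single (h : Matrix.SpecialLinearGroup (Fin d) 𝕜) (i : Fin d) :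
    h.1ᴴ *ᵥ ((h.1⁻¹)ᴴ *ᵥ Pi.single i 1) = Pi.single i 1 := by
  rw [Matrix.mulVec_mulVec, ← inv_conjTranspose_eq,
    Matrix.mul_nonsing_inv _ (isUnit_det_conjTranspose h), Matrix.one_mulVec]

theorem mulVec_single_ne_zero {h : Matrix (Fin d) (Fin d) 𝕜} (hh : IsUnit h.det) (i : Fin d) :
    h *ᵥ Pi.single i 1 ≠ 0 := by
  intro h0
  obtain ⟨j, hj⟩ := mulVec_ne_zero hh (v := Pi.single i (1 : 𝕜)) (by simp)
  exact hj (congrFun h0 j)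

variable [d.AtLeastTwo]

theorem asymptotic_of_endpoint_eq {c c' : GeodesicRay d 𝕜} (h : c.endpoint = c'.endpoint) :
    Asymptotic c c' := Quotient.exact h

/-- Along asymptotic rays, `p ↦ log (v† p⁻¹ v)` decays at the same rate; this rate is the
smallest exponent that `v` meets in the frame of the ray. -/
theorem le_apply_of_asymptotic {g h : Matrix.SpecialLinearGroup (Fin d) 𝕜} {A B : ModelChamber d}
    (hs : Asymptotic (standardRay g A) (standardRay h B)) {v : Fin d → 𝕜} {b : ℝ}
    (hb : ∀ j, (h.1⁻¹ *ᵥ v) j ≠ 0 → b ≤ B.1 j) {i : Fin d} (hi : (g.1⁻¹ *ᵥ v) i ≠ 0) :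
    b ≤ A.1 i := by
  obtain ⟨C, hC⟩ := hs
  have hv : v ≠ 0 := by rintro rfl; simp at hi
  obtain ⟨j, hj⟩ := mulVec_ne_zero (isUnit_det_inv h) hv
  have := exponent_le_of_abs_log_sub_le (a := fun i => -(2 * A.1 i)) (b := fun i => -(2 * B.1 i))
    (m := fun i => ‖(g.1⁻¹ *ᵥ v) i‖ ^ 2) (n := fun i => ‖(h.1⁻¹ *ᵥ v) i‖ ^ 2)
    (C := √2 * C) (β := -(2 * b)) (fun i => by positivity) (fun i => by positivity)
    ⟨j, by positivity⟩ (fun t ht => ?_) (fun j hj => ?_) (i := i) (by positivity)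
  · linarith
  · have h1 := (abs_log_hermQuad_inv_sub_le v ((standardRay h B).toFun t)
      ((standardRay g A).toFun t)).trans
      (mul_le_mul_of_nonneg_left ((riemDist_comm _ _).trans_le (hC t ht)) (Real.sqrt_nonneg 2))
    rw [standardRay_toFun, standardRay_toFun, hermQuad_flatCurve_inv,
      hermQuad_flatCurve_inv] at h1
    simpa only [neg_mul] using h1
  · have h1 : (h.1⁻¹ *ᵥ v) j ≠ 0 := by
      intro h0; rw [h0] at hj; simp at hj
    linarith [hb j h1]

/-- The counterpart of `le_apply_of_asymptotic` for the growth of `p ↦ log (v† p v)`. -/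
theorem apply_le_of_asymptotic {g h : Matrix.SpecialLinearGroup (Fin d) 𝕜} {A B : ModelChamber d}
    (hs : Asymptotic (standardRay g A) (standardRay h B)) {v : Fin d → 𝕜} {b : ℝ}
    (hb : ∀ j, (h.1ᴴ *ᵥ v) j ≠ 0 → B.1 j ≤ b) {i : Fin d} (hi : (g.1ᴴ *ᵥ v) i ≠ 0) :
    A.1 i ≤ b := by
  obtain ⟨C, hC⟩ := hs
  have hv : v ≠ 0 := by rintro rfl; simp at hi
  obtain ⟨j, hj⟩ := mulVec_ne_zero (isUnit_det_conjTranspose h) hv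
  have := exponent_le_of_abs_log_sub_le (a := fun i => 2 * A.1 i) (b := fun i => 2 * B.1 i)
    (m := fun i => ‖(g.1ᴴ *ᵥ v) i‖ ^ 2) (n := fun i => ‖(h.1ᴴ *ᵥ v) i‖ ^ 2)
    (C := √2 * C) (β := 2 * b) (fun i => by positivity) (fun i => by positivity)
    ⟨j, by positivity⟩ (fun t ht => ?_) (fun j hj => ?_) (i := i) (by positivity)
  · linarith
  · have h1 := (abs_log_hermQuad_sub_le v ((standardRay h B).toFun t)
      ((standardRay g A).toFun t)).trans
      (mul_le_mul_of_nonneg_left ((riemDist_comm _ _).trans_le (hC t ht)) (Real.sqrt_nonneg 2))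
    rwa [standardRay_toFun, standardRay_toFun, hermQuad_flatCurve, hermQuad_flatCurve] at h1
  · have h1 : (h.1ᴴ *ᵥ v) j ≠ 0 := by
      intro h0; rw [h0] at hj; simp at hj
    linarith [hb j h1]

theorem inv_mulVec_single (h : Matrix.SpecialLinearGroup (Fin d) 𝕜) :
    h.1⁻¹ *ᵥ (h.1 *ᵥ Pi.single 0 1) = Pi.single 0 1 := by
  rw [Matrix.mulVec_mulVec, Matrix.nonsing_inv_mul _ (isUnit_det h), Matrix.one_mulVec]

theorem fst_le_of_asymptotic {g h : Matrix.SpecialLinearGroup (Fin d) 𝕜} {A B : ModelChamber d}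
    (hs : Asymptotic (standardRay g A) (standardRay h B)) {i : Fin d}
    (hi : (g.1⁻¹ *ᵥ (h.1 *ᵥ Pi.single 0 1)) i ≠ 0) : B.1 0 ≤ A.1 i := by
  refine le_apply_of_asymptotic hs (fun j hj => ?_) hi
  rw [inv_mulVec_single] at hj
  by_cases hj0 : j = 0
  · rw [hj0]
  · exact absurd (Pi.single_eq_of_ne hj0 _) hj

theorem fst_eq_of_asymptotic {g h : Matrix.SpecialLinearGroup (Fin d) 𝕜} {A B : ModelChamber d}
    (hs : Asymptotic (standardRay g A) (standardRay h B)) : A.1 0 = B.1 0 := by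
  have key : ∀ {g h : Matrix.SpecialLinearGroup (Fin d) 𝕜} {A B : ModelChamber d},
      Asymptotic (standardRay g A) (standardRay h B) → B.1 0 ≤ A.1 0 := by
    intro g h A B hs
    obtain ⟨i, hi⟩ := mulVec_ne_zero (isUnit_det_inv g) (mulVec_single_ne_zero (isUnit_det h) 0)
    exact (fst_le_of_asymptotic hs hi).trans (A.2.1 (Fin.zero_le i))
  exact le_antisymm (key ((asymptoticSetoid d 𝕜).symm hs)) (key hs)

theorem le_rev_zero (i : Fin d) : i ≤ Fin.rev 0 := by
  have := i.isLt
  rw [Fin.le_def, Fin.val_rev]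
  simp
  omega

theorem rev_zero_ne_zero : (Fin.rev 0 : Fin d) ≠ 0 := by
  intro h
  have h1 := congrArg Fin.val h
  have : 2 ≤ d := Nat.AtLeastTwo.prop
  simp [Fin.val_rev] at h1
  omega

theorem last_eq_of_asymptotic {g h : Matrix.SpecialLinearGroup (Fin d) 𝕜} {A B : ModelChamber d}
    (hs : Asymptotic (standardRay g A) (standardRay h B)) :
    A.1 (Fin.rev 0) = B.1 (Fin.rev 0) := by
  have key : ∀ {g h : Matrix.SpecialLinearGroup (Fin d) 𝕜} {A B : ModelChamber d},
      Asymptotic (standardRay g A) (standardRay h B) → A.1 (Fin.rev 0) ≤ B.1 (Fin.rev 0) := by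
    intro g h A B hs
    have hu : IsUnit ((h.1⁻¹)ᴴ).det := by
      rw [← inv_conjTranspose_eq]
      exact Matrix.isUnit_nonsing_inv_det _ (isUnit_det_conjTranspose h)
    obtain ⟨i, hi⟩ := mulVec_ne_zero (isUnit_det_conjTranspose g)
      (mulVec_single_ne_zero hu (Fin.rev 0))
    refine (A.2.1 (le_rev_zero i)).trans (apply_le_of_asymptotic hs (fun j hj => ?_) hi)
    rw [conjTranspose_mulVec_single] at hj
    by_cases hj0 : j = Fin.rev 0
    · rw [hj0]
    · exact absurd (Pi.single_eq_of_ne hj0 _) hj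
  exact le_antisymm (key hs) (key ((asymptoticSetoid d 𝕜).symm hs))

theorem flagType_zero : (flagType d).1 0 = 1 / 2 := by simp [flagType]

theorem flagType_last : (flagType d).1 (Fin.rev 0) = -1 / 2 := by
  simp only [flagType, if_neg (rev_zero_ne_zero (d := d)), if_true]

theorem flagType_of_ne {i : Fin d} (h0 : i ≠ 0) (hl : i ≠ Fin.rev 0) : (flagType d).1 i = 0 := by
  simp only [flagType, if_neg h0, if_neg hl]

/-- The extreme entries `± ½` exhaust the norm of a unit vector. -/
theorem eq_flagType {A : ModelChamber d} (h0 : A.1 0 = 1 / 2)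
    (hl : A.1 (Fin.rev 0) = -1 / 2) : A = flagType d := by
  have key : ∀ i, i ≠ 0 → i ≠ Fin.rev 0 → A.1 i = 0 := by
    intro i hi0 hil
    have h1 : ∑ j ∈ ({0, Fin.rev 0, i} : Finset (Fin d)), A.1 j ^ 2 ≤ ∑ j, A.1 j ^ 2 :=
      Finset.sum_le_sum_of_subset_of_nonneg (Finset.subset_univ _) fun _ _ _ => sq_nonneg _
    rw [Finset.sum_insert (by simp [rev_zero_ne_zero.symm, hi0.symm]),
      Finset.sum_insert (by simp [hil.symm]), Finset.sum_singleton, h0, hl] at h1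
    have h2 := A.2.2.2
    have h3 : A.1 i ^ 2 ≤ 0 := by linarith
    exact pow_eq_zero_iff two_ne_zero |>.1 (le_antisymm h3 (sq_nonneg _))
  refine Subtype.ext (funext fun i => ?_)
  by_cases hi0 : i = 0
  · rw [hi0, h0, flagType_zero]
  · by_cases hil : i = Fin.rev 0
    · rw [hil, hl, flagType_last]
    · rw [key i hi0 hil, flagType_of_ne hi0 hil]

end GrowthRates

/-! ### Asymptotics of relative eigenvalues -/

section RelativeEigenvalues

variable {d : ℕ} {𝕜 : Type*} [RCLike 𝕜]

theorem hermQuad_mulVec_single (q h : Matrix (Fin d) (Fin d) 𝕜) (i : Fin d) :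
    hermQuad q (h *ᵥ Pi.single i 1) = RCLike.re ((hᴴ * q * h) i i) := by
  have := hermQuad_conj hᴴ q (Pi.single i (1 : 𝕜))
  rw [Matrix.conjTranspose_conjTranspose] at this
  rw [← this, hermQuad]
  congr 1
  simp [Matrix.mulVec_single]

/-- Power sums of the eigenvalues `e` of `g E g†` relative to `G G†`. -/
theorem trace_relative {G g : Matrix (Fin d) (Fin d) 𝕜} (hG : IsUnit G.det) {e E : Fin d → ℝ}
    (h : G * Matrix.diagonal (fun i => ((e i : ℝ) : 𝕜)) * Gᴴ =
      g * Matrix.diagonal (fun i => ((E i : ℝ) : 𝕜)) * gᴴ) :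
    Matrix.trace ((gᴴ * (G * Gᴴ)⁻¹ * g) * Matrix.diagonal (fun i => ((E i : ℝ) : 𝕜))) =
        ((∑ i, e i : ℝ) : 𝕜) ∧
      Matrix.trace (((gᴴ * (G * Gᴴ)⁻¹ * g) * Matrix.diagonal (fun i => ((E i : ℝ) : 𝕜))) *
        ((gᴴ * (G * Gᴴ)⁻¹ * g) * Matrix.diagonal (fun i => ((E i : ℝ) : 𝕜)))) =
        ((∑ i, e i ^ 2 : ℝ) : 𝕜) := by
  have hG' : IsUnit Gᴴ.det := by rw [Matrix.det_conjTranspose]; exact hG.star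
  set D := Matrix.diagonal (fun i => ((e i : ℝ) : 𝕜)) with hD
  set F := Matrix.diagonal (fun i => ((E i : ℝ) : 𝕜)) with hF
  set P := (G * Gᴴ)⁻¹ with hP
  have h1 : P * (g * F * gᴴ) = (Gᴴ)⁻¹ * D * Gᴴ := by
    rw [← h, hP, Matrix.mul_inv_rev]
    simp only [Matrix.mul_assoc]
    rw [Matrix.nonsing_inv_mul_cancel_left _ _ hG]
  constructor
  · calc Matrix.trace (gᴴ * P * g * F) = Matrix.trace (gᴴ * (P * (g * F))) := by
          simp only [Matrix.mul_assoc]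
      _ = Matrix.trace (P * (g * F * gᴴ)) := by
          rw [Matrix.trace_mul_comm]; simp only [Matrix.mul_assoc]
      _ = Matrix.trace D := by
          rw [h1, Matrix.trace_mul_comm, ← Matrix.mul_assoc, Matrix.mul_nonsing_inv _ hG',
            Matrix.one_mul]
      _ = _ := by rw [hD, Matrix.trace_diagonal, RCLike.ofReal_sum]
  · calc Matrix.trace (gᴴ * P * g * F * (gᴴ * P * g * F))
        = Matrix.trace (gᴴ * (P * (g * F * gᴴ) * (P * (g * F)))) := by
          simp only [Matrix.mul_assoc]
      _ = Matrix.trace ((P * (g * F * gᴴ)) * (P * (g * F * gᴴ))) := by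
          rw [Matrix.trace_mul_comm]; simp only [Matrix.mul_assoc]
      _ = Matrix.trace ((Gᴴ)⁻¹ * (D * (Gᴴ * (Gᴴ)⁻¹) * (D * Gᴴ))) := by
          rw [h1]; simp only [Matrix.mul_assoc]
      _ = Matrix.trace (D * D) := by
          rw [Matrix.mul_nonsing_inv _ hG', Matrix.mul_one, Matrix.trace_mul_comm,
            ← Matrix.mul_assoc, Matrix.mul_assoc, Matrix.mul_nonsing_inv _ hG', Matrix.mul_one]
      _ = _ := by
          rw [hD, Matrix.diagonal_mul_diagonal, Matrix.trace_diagonal, RCLike.ofReal_sum]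
          refine Finset.sum_congr rfl fun i _ => ?_
          rw [← RCLike.ofReal_mul, sq]

theorem mul_le_sq_sum_sub_sum_sq {e : Fin d → ℝ} (he : ∀ i, 0 < e i) {i j : Fin d}
    (hij : i ≠ j) : e i * e j ≤ (∑ k, e k) ^ 2 - ∑ k, e k ^ 2 := by
  have h1 : (∑ k, e k) ^ 2 - ∑ k, e k ^ 2 = ∑ k, ∑ l ∈ Finset.univ.erase k, e k * e l := by
    rw [sq, Finset.sum_mul, ← Finset.sum_sub_distrib]
    refine Finset.sum_congr rfl fun k _ => ?_
    rw [Finset.mul_sum, ← Finset.add_sum_erase _ _ (Finset.mem_univ k)]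
    ring
  rw [h1]
  have h2 : ∀ k l, 0 ≤ e k * e l := fun k l => (mul_pos (he k) (he l)).le
  exact (Finset.single_le_sum (f := fun l => e i * e l) (fun l _ => h2 i l)
    (Finset.mem_erase.2 ⟨hij.symm, Finset.mem_univ j⟩)).trans
    (Finset.single_le_sum (f := fun k => ∑ l ∈ Finset.univ.erase k, e k * e l)
      (fun k _ => Finset.sum_nonneg fun l _ => h2 k l) (Finset.mem_univ i))

/-- Let `R` be a fixed positive definite matrix and `E = Diag(E_i)` with `E_{i₀} = s ≥ 1` and all
other entries in `[0,1]`. Uniformly in `s`, the largest eigenvalue of `R E` is at most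
`R_{i₀i₀} s + O(1)` and the others are `O(1)`: the sum of the products of two eigenvalues is a sum
of `2 × 2` minors of `R E`, hence `O(s)`. -/
theorem exists_eigenvalue_bound {R : Matrix (Fin d) (Fin d) 𝕜} (hR : R.PosDef) (i₀ : Fin d) :
    ∃ K : ℝ, 0 < K ∧ ∀ (s : ℝ) (E e : Fin d → ℝ), 1 ≤ s → E i₀ = s → (∀ i, 0 ≤ E i) →
      (∀ i, i ≠ i₀ → E i ≤ 1) → (∀ i, 0 < e i) → (∀ i, e i ≤ e i₀) →
      Matrix.trace (R * Matrix.diagonal (fun i => ((E i : ℝ) : 𝕜))) = ((∑ i, e i : ℝ) : 𝕜) →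
      Matrix.trace ((R * Matrix.diagonal (fun i => ((E i : ℝ) : 𝕜))) *
        (R * Matrix.diagonal (fun i => ((E i : ℝ) : 𝕜)))) = ((∑ i, e i ^ 2 : ℝ) : 𝕜) →
      e i₀ ≤ RCLike.re (R i₀ i₀) * s + K ∧ ∀ i, i ≠ i₀ → e i ≤ K := by
  have hdiag : ∀ i, 0 < RCLike.re (R i i) := fun i => (RCLike.pos_iff.1 hR.diag_pos).1
  set r := RCLike.re (R i₀ i₀) with hr
  set K₁ := ∑ i, RCLike.re (R i i) with hK₁
  set K₂ := ∑ i, ∑ j, (‖R i i‖ * ‖R j j‖ + ‖R i j‖ * ‖R j i‖) with hK₂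
  have hK₁0 : 0 < K₁ := Finset.sum_pos (fun i _ => hdiag i) ⟨i₀, Finset.mem_univ _⟩
  have hK₂0 : 0 ≤ K₂ := Finset.sum_nonneg fun i _ => Finset.sum_nonneg fun j _ => by positivity
  refine ⟨K₁ + K₂ * d / r, by have := hdiag i₀; positivity, ?_⟩
  intro s E e hs hEs hE0 hE1 he hmax htr htr2
  have hsum : ∑ i, e i = ∑ i, RCLike.re (R i i) * E i := by
    have h1 := congrArg RCLike.re htr
    rw [RCLike.ofReal_re] at h1
    rw [← h1, Matrix.trace, map_sum]
    refine Finset.sum_congr rfl fun i _ => ?_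
    rw [Matrix.diag_apply, Matrix.mul_diagonal, RCLike.re_mul_ofReal]
  have hle : e i₀ ≤ r * s + K₁ := by
    calc e i₀ ≤ ∑ i, e i :=
          Finset.single_le_sum (fun i _ => (he i).le) (Finset.mem_univ i₀)
      _ = ∑ i, RCLike.re (R i i) * E i := hsum
      _ = r * s + ∑ i ∈ Finset.univ.erase i₀, RCLike.re (R i i) * E i := by
          rw [← Finset.add_sum_erase _ _ (Finset.mem_univ i₀), hEs]
      _ ≤ r * s + ∑ i ∈ Finset.univ.erase i₀, RCLike.re (R i i) := by
          gcongr with i hi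
          exact mul_le_of_le_one_right (hdiag i).le (hE1 i (Finset.ne_of_mem_erase hi))
      _ ≤ r * s + K₁ := by
          gcongr
          exact Finset.sum_le_sum_of_subset_of_nonneg (Finset.erase_subset _ _)
            fun i _ _ => (hdiag i).le
  have hge : r * s ≤ d * e i₀ := by
    calc r * s ≤ ∑ i, RCLike.re (R i i) * E i := by
          rw [← hEs]
          exact Finset.single_le_sum (f := fun i => RCLike.re (R i i) * E i)
            (fun i _ => mul_nonneg (hdiag i).le (hE0 i)) (Finset.mem_univ i₀)
      _ = ∑ i, e i := hsum.symm
      _ ≤ ∑ _i : Fin d, e i₀ := Finset.sum_le_sum fun i _ => hmax i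
      _ = d * e i₀ := by simp
  have hE2 : ∀ i j, i ≠ j → E i * E j ≤ s := by
    intro i j hij
    by_cases hi : i = i₀
    · rw [hi, hEs]
      exact mul_le_of_le_one_right (by linarith) (hE1 j (fun h => hij (hi.trans h.symm)))
    · by_cases hj : j = i₀
      · rw [hj, hEs]
        exact mul_le_of_le_one_left (by linarith) (hE1 i hi)
      · exact (mul_le_one₀ (hE1 i hi) (hE0 j) (hE1 j hj)).trans hs
  have hminor : (∑ k, e k) ^ 2 - ∑ k, e k ^ 2 ≤ K₂ * s := by
    have h1 : (((∑ k, e k) ^ 2 - ∑ k, e k ^ 2 : ℝ) : 𝕜) =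
        ∑ i, ∑ j, (R i i * R j j - R i j * R j i) * ((E i * E j : ℝ) : 𝕜) := by
      rw [RCLike.ofReal_sub, RCLike.ofReal_pow, ← htr, ← htr2, sq]
      simp only [Matrix.trace, Matrix.diag_apply, Matrix.mul_diagonal]
      rw [Finset.sum_mul, ← Finset.sum_sub_distrib]
      refine Finset.sum_congr rfl fun i _ => ?_
      rw [Finset.mul_sum, Matrix.mul_apply, ← Finset.sum_sub_distrib]
      refine Finset.sum_congr rfl fun j _ => ?_
      simp only [Matrix.mul_diagonal]
      push_cast
      ring
    calc (∑ k, e k) ^ 2 - ∑ k, e k ^ 2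
        ≤ ‖(((∑ k, e k) ^ 2 - ∑ k, e k ^ 2 : ℝ) : 𝕜)‖ := by
          rw [RCLike.norm_ofReal]; exact le_abs_self _
      _ ≤ ∑ i, ∑ j, ‖(R i i * R j j - R i j * R j i) * ((E i * E j : ℝ) : 𝕜)‖ := by
          rw [h1]
          exact (norm_sum_le _ _).trans (Finset.sum_le_sum fun i _ => norm_sum_le _ _)
      _ ≤ ∑ i, ∑ j, (‖R i i‖ * ‖R j j‖ + ‖R i j‖ * ‖R j i‖) * s := by
          refine Finset.sum_le_sum fun i _ => Finset.sum_le_sum fun j _ => ?_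
          by_cases hij : i = j
          · subst hij
            rw [sub_self, zero_mul, norm_zero]
            positivity
          · rw [norm_mul, RCLike.norm_ofReal, abs_of_nonneg (mul_nonneg (hE0 i) (hE0 j))]
            refine mul_le_mul ?_ (hE2 i j hij) (mul_nonneg (hE0 i) (hE0 j)) (by positivity)
            rw [← norm_mul, ← norm_mul]
            exact norm_sub_le _ _
      _ = K₂ * s := by rw [hK₂, Finset.sum_mul]; simp only [Finset.sum_mul]
  refine ⟨hle.trans (by have := hdiag i₀; gcongr; simp; positivity), fun i hi => ?_⟩
  have h1 : e i * e i₀ ≤ K₂ * s := (mul_le_sq_sum_sub_sum_sq he hi).trans hminor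
  have hr0 : 0 < r := hdiag i₀
  have hs0 : 0 < s := by linarith
  have h2 : e i * r ≤ K₂ * d := by
    have h3 : e i * r * s ≤ K₂ * d * s := by
      calc e i * r * s = e i * (r * s) := by ring
        _ ≤ e i * (d * e i₀) := mul_le_mul_of_nonneg_left hge (he i).le
        _ = d * (e i * e i₀) := by ring
        _ ≤ d * (K₂ * s) := by gcongr
        _ = _ := by ring
    exact le_of_mul_le_mul_right h3 hs0
  have h3 : e i ≤ K₂ * d / r := by rwa [le_div_iff₀ hr0]
  linarith

end RelativeEigenvalues

/-! ### Busemann functions of flag type -/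

section BusemannLimit

theorem tendsto_log_add_mul_exp_neg {r : ℝ} (hr : 0 < r) (K : ℝ) :
    Filter.Tendsto (fun t : ℝ => Real.log (r + K * Real.exp (-t))) Filter.atTop
      (𝓝 (Real.log r)) := by
  have h1 : Filter.Tendsto (fun t : ℝ => r + K * Real.exp (-t)) Filter.atTop (𝓝 r) := by
    simpa using (Real.tendsto_exp_neg_atTop_nhds_zero.const_mul K).const_add r
  exact h1.log hr.ne'

/-- `√(½ (t + u)² + ½ (t + v)² + M) = t + ½ (u + v) + O(1/t)`, as an upper bound. -/
theorem sqrt_le_add_div {t u v M X : ℝ} (ht : 0 < t + (u + v) / 2) (hM : 0 ≤ M)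
    (hX : X ≤ (t + u) ^ 2 / 2 + (t + v) ^ 2 / 2 + M) :
    √X ≤ t + (u + v) / 2 + ((u - v) ^ 2 / 4 + M) / (2 * (t + (u + v) / 2)) := by
  set m := t + (u + v) / 2 with hm
  set r := (u - v) ^ 2 / 4 + M with hr
  have h1 : X ≤ m ^ 2 + r := by
    refine hX.trans (le_of_eq ?_)
    rw [hm, hr]; ring
  rcases le_total X 0 with h0 | h0
  · rw [Real.sqrt_eq_zero_of_nonpos h0]
    have h2 : 0 ≤ r := by positivity
    positivity
  · rw [← sub_nonneg]
    have h2 := Real.sq_sqrt h0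
    have h3 : m + r / (2 * m) - √X = ((√X - m) ^ 2 + (m ^ 2 + r - X)) / (2 * m) := by
      field_simp
      nlinarith
    rw [h3]
    exact div_nonneg (by nlinarith [sq_nonneg (√X - m)]) (by linarith)

theorem nonneg_of_antitone_of_sum_eq_zero {d : ℕ} [d.AtLeastTwo] {a : Fin d → ℝ}
    (ha : Antitone a) (h0 : ∑ i, a i = 0) : 0 ≤ a 0 ∧ a (Fin.rev 0) ≤ 0 := by
  constructor
  · by_contra! h
    have : ∑ i, a i < 0 := Finset.sum_neg (fun i _ => (ha (Fin.zero_le i)).trans_lt h)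
      ⟨0, Finset.mem_univ _⟩
    linarith
  · by_contra! h
    have : 0 < ∑ i, a i := Finset.sum_pos (fun i _ => h.trans_le (ha (le_rev_zero i)))
      ⟨0, Finset.mem_univ _⟩
    linarith

theorem le_log_of_exp_le {a r K t : ℝ} (hr : 0 < r) (hK : 0 < K)
    (h : Real.exp a ≤ r * Real.exp t + K) : a ≤ t + Real.log (r + K * Real.exp (-t)) := by
  rw [← Real.exp_le_exp, Real.exp_add, Real.exp_log (by positivity)]
  refine h.trans (le_of_eq ?_)
  have h1 : Real.exp t * Real.exp (-t) = 1 := by rw [← Real.exp_add]; simp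
  linear_combination -K * h1

variable {d : ℕ} {𝕜 : Type*} [RCLike 𝕜] [d.AtLeastTwo]

theorem sum_sq_le_of_middle_bounded {a : Fin d → ℝ} {L : ℝ}
    (h : ∀ i, i ≠ 0 → i ≠ Fin.rev 0 → |a i| ≤ L) :
    ∑ i, a i ^ 2 ≤ a 0 ^ 2 + a (Fin.rev 0) ^ 2 + d * L ^ 2 := by
  have h1 : ∀ i, a i ^ 2 ≤ (if i = 0 then a 0 ^ 2 else 0) +
      (if i = Fin.rev 0 then a (Fin.rev 0) ^ 2 else 0) + L ^ 2 := by
    intro i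
    by_cases h0 : i = 0
    · subst h0
      rw [if_pos rfl]
      split_ifs <;> nlinarith [sq_nonneg L, sq_nonneg (a (Fin.rev 0))]
    · by_cases hl : i = Fin.rev 0
      · subst hl
        rw [if_pos rfl, if_neg h0]
        nlinarith [sq_nonneg L]
      · rw [if_neg h0, if_neg hl]
        have := sq_le_sq' (abs_le.1 (h i h0 hl)).1 (abs_le.1 (h i h0 hl)).2
        linarith
  refine (Finset.sum_le_sum fun i _ => h1 i).trans (le_of_eq ?_)
  simp [Finset.sum_add_distrib]

/-- The eigenvalue estimate for the points of the ray `g exp(tW).I_d`: up to a bounded error, only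
the extreme entries of the vector-valued distance from `p` contribute. -/
theorem exists_riemDist_le (g : Matrix.SpecialLinearGroup (Fin d) 𝕜) (p : SymSpace d 𝕜) :
    ∃ K K' M : ℝ, 0 ≤ M ∧ ∀ t, 0 ≤ t →
      riemDist p ((standardRay g (flagType d)).toFun t) ≤
        √((t + Real.log (hermQuad p.1⁻¹ (g.1 *ᵥ Pi.single 0 1) + K * Real.exp (-t))) ^ 2 / 2 +
          (t + Real.log (hermQuad p.1 ((g.1⁻¹)ᴴ *ᵥ Pi.single (Fin.rev 0) 1) +
            K' * Real.exp (-t))) ^ 2 / 2 + M) := by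
  have hgu : IsUnit g.1 := (Matrix.isUnit_iff_isUnit_det _).2 (isUnit_det g)
  have hgu' : IsUnit (g.1⁻¹)ᴴ := by
    rw [← inv_conjTranspose_eq]
    exact (Matrix.isUnit_iff_isUnit_det _).2
      (Matrix.isUnit_nonsing_inv_det _ (isUnit_det_conjTranspose g))
  have hR : (g.1ᴴ * p.1⁻¹ * g.1).PosDef :=
    (Matrix.IsUnit.posDef_star_left_conjugate_iff hgu).2 p.2.1.inv
  have hR' : (((g.1⁻¹)ᴴ)ᴴ * p.1 * (g.1⁻¹)ᴴ).PosDef :=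
    (Matrix.IsUnit.posDef_star_left_conjugate_iff hgu').2 p.2.1
  obtain ⟨K, hK0, hK⟩ := exists_eigenvalue_bound hR 0
  obtain ⟨K', hK'0, hK'⟩ := exists_eigenvalue_bound hR' (Fin.rev 0)
  set L := |Real.log K| + |Real.log K'| with hL
  refine ⟨K, K', d * L ^ 2 / 2, by positivity, fun t ht => ?_⟩
  set W := (flagType d).1 with hW
  have hq := vectorDist_spec p ((standardRay g (flagType d)).toFun t)
  set a := vectorDist p ((standardRay g (flagType d)).toFun t) with ha
  refine hq.riemDist_le.trans (Real.sqrt_le_sqrt ?_)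
  obtain ⟨hanti, hsum, G, hp, hc⟩ := hq
  have hp' : p.1 = G.1 * G.1ᴴ := by rw [hp, smul_base_val]
  have hrel : G.1 * Matrix.diagonal (fun i => ((Real.exp (2 * a i) : ℝ) : 𝕜)) * G.1ᴴ =
      g.1 * Matrix.diagonal (fun i => ((Real.exp (2 * W i * t) : ℝ) : 𝕜)) * g.1ᴴ := by
    have h1 := congrArg Subtype.val hc
    rw [flat_val, standardRay_toFun, flatCurve_val] at h1
    exact h1.symm
  have hrel' := congrArg (·⁻¹) hrel
  simp only [inv_conj_diagonal_exp] at hrel'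
  have hGi : (G.1⁻¹)ᴴ * ((G.1⁻¹)ᴴ)ᴴ = p.1⁻¹ := by
    rw [hp', inv_mul_conjTranspose, inv_conjTranspose_eq, Matrix.conjTranspose_conjTranspose]
  have hGu : IsUnit ((G.1⁻¹)ᴴ).det := by
    rw [← inv_conjTranspose_eq]
    exact Matrix.isUnit_nonsing_inv_det _ (isUnit_det_conjTranspose G)
  have hpp : (p.1⁻¹)⁻¹ = p.1 := Matrix.nonsing_inv_nonsing_inv _ (by rw [p.2.2]; exact isUnit_one)
  obtain ⟨htr, htr2⟩ := trace_relative (isUnit_det G) hrel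
  obtain ⟨htr', htr2'⟩ := trace_relative hGu hrel'
  rw [← hp'] at htr htr2
  rw [hGi, hpp] at htr' htr2'
  have hW0 : W 0 = 1 / 2 := flagType_zero
  have hWl : W (Fin.rev 0) = -1 / 2 := flagType_last
  have hW0' : ∀ i, i ≠ 0 → W i ≤ 0 := by
    intro i hi
    by_cases hil : i = Fin.rev 0
    · rw [hil, hWl]; norm_num
    · exact (flagType_of_ne hi hil).le
  have hWl' : ∀ i, i ≠ Fin.rev 0 → 0 ≤ W i := by
    intro i hi
    by_cases hi0 : i = 0
    · rw [hi0, hW0]; norm_num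
    · exact (flagType_of_ne hi0 hi).ge
  obtain ⟨h1, h2⟩ := hK (Real.exp t) _ _ (Real.one_le_exp ht)
    (by rw [hW0]; ring_nf) (fun i => (Real.exp_pos _).le)
    (fun i hi => Real.exp_le_one_iff.2 (by nlinarith [hW0' i hi])) (fun i => Real.exp_pos _)
    (fun i => Real.exp_le_exp.2 (by linarith [hanti (Fin.zero_le i)])) htr htr2
  obtain ⟨h1', h2'⟩ := hK' (Real.exp t) _ _ (Real.one_le_exp ht)
    (by rw [hWl]; ring_nf) (fun i => (Real.exp_pos _).le)
    (fun i hi => Real.exp_le_one_iff.2 (by nlinarith [hWl' i hi])) (fun i => Real.exp_pos _)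
    (fun i => Real.exp_le_exp.2 (by linarith [hanti (le_rev_zero i)])) htr' htr2'
  rw [← hermQuad_mulVec_single] at h1 h1'
  have hpos := hermQuad_pos p.2.1.inv (mulVec_single_ne_zero (isUnit_det g) 0)
  have hpos' := hermQuad_pos p.2.1 (mulVec_single_ne_zero
    ((Matrix.isUnit_iff_isUnit_det _).1 hgu') (Fin.rev 0))
  have b1 := le_log_of_exp_le hpos hK0 h1
  have b2 := le_log_of_exp_le hpos' hK'0 h1'
  obtain ⟨n1, n2⟩ := nonneg_of_antitone_of_sum_eq_zero hanti hsum
  have hmid : ∀ i, i ≠ 0 → i ≠ Fin.rev 0 → |2 * a i| ≤ L := by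
    intro i hi hil
    have m1 := (Real.le_log_iff_exp_le hK0).2 (h2 i hi)
    have m2 := (Real.le_log_iff_exp_le hK'0).2 (h2' i hil)
    have := le_abs_self (Real.log K)
    have := le_abs_self (Real.log K')
    have := abs_nonneg (Real.log K)
    have := abs_nonneg (Real.log K')
    rw [abs_le]
    constructor <;> linarith
  have hs := sum_sq_le_of_middle_bounded hmid
  have e1 : ∑ i, (2 * a i) ^ 2 = 4 * ∑ i, a i ^ 2 := by
    rw [Finset.mul_sum]; exact Finset.sum_congr rfl fun i _ => by ring
  rw [e1] at hs
  have q1 := pow_le_pow_left₀ (by linarith) b1 2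
  have q2 := pow_le_pow_left₀ (by linarith) b2 2
  rw [neg_sq] at q2
  linarith

/-- The Busemann function of the ray `g exp(tW).I_d` of flag type is
`p ↦ ½ (log (w† p⁻¹ w) + log (u† p u))`, where `w = g e₁` spans the line of the flag and `u†`
is a linear form defining its hyperplane. -/
theorem tendsto_riemDist_sub (g : Matrix.SpecialLinearGroup (Fin d) 𝕜) (p : SymSpace d 𝕜) :
    Filter.Tendsto (fun t => riemDist p ((standardRay g (flagType d)).toFun t) - t) Filter.atTop
      (𝓝 ((Real.log (hermQuad p.1⁻¹ (g.1 *ᵥ Pi.single 0 1)) +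
        Real.log (hermQuad p.1 ((g.1⁻¹)ᴴ *ᵥ Pi.single (Fin.rev 0) 1))) / 2)) := by
  obtain ⟨K, K', M, hM, hle⟩ := exists_riemDist_le g p
  set w := g.1 *ᵥ Pi.single 0 1 with hw
  set u := (g.1⁻¹)ᴴ *ᵥ Pi.single (Fin.rev 0) 1 with hu
  have hpos : 0 < hermQuad p.1⁻¹ w :=
    hermQuad_pos p.2.1.inv (mulVec_single_ne_zero (isUnit_det g) 0)
  have hpos' : 0 < hermQuad p.1 u := by
    refine hermQuad_pos p.2.1 (mulVec_single_ne_zero ?_ (Fin.rev 0))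
    rw [← inv_conjTranspose_eq]
    exact Matrix.isUnit_nonsing_inv_det _ (isUnit_det_conjTranspose g)
  set U := fun t : ℝ => Real.log (hermQuad p.1⁻¹ w + K * Real.exp (-t)) with hU
  set V := fun t : ℝ => Real.log (hermQuad p.1 u + K' * Real.exp (-t)) with hV
  have tU : Filter.Tendsto U Filter.atTop _ := tendsto_log_add_mul_exp_neg hpos K
  have tV : Filter.Tendsto V Filter.atTop _ := tendsto_log_add_mul_exp_neg hpos' K'
  have tm := (tU.add tV).div_const 2
  have tm' : Filter.Tendsto (fun t => t + (U t + V t) / 2) Filter.atTop Filter.atTop :=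
    Filter.tendsto_id.atTop_add tm
  have tr : Filter.Tendsto (fun t => ((U t - V t) ^ 2 / 4 + M) / (2 * (t + (U t + V t) / 2)))
      Filter.atTop (𝓝 0) :=
    ((((tU.sub tV).pow 2).div_const 4).add_const M).div_atTop
      (tm'.const_mul_atTop two_pos)
  have tub := tm.add tr
  rw [add_zero] at tub
  refine tendsto_of_tendsto_of_tendsto_of_le_of_le' tendsto_const_nhds tub ?_ ?_
  · -- The limit function is `1`-Lipschitz and equals `-t` at the point of parameter `t`.
    refine Filter.Eventually.of_forall fun t => ?_
    have horth : Star.star u ⬝ᵥ w = 0 := by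
      rw [hu, hw, Matrix.star_mulVec, Matrix.conjTranspose_conjTranspose,
        ← Matrix.dotProduct_mulVec, inv_mulVec_single]
      simp [rev_zero_ne_zero]
    have h1 := half_log_sub_le_riemDist horth p ((standardRay g (flagType d)).toFun t)
    have e1 : hermQuad ((standardRay g (flagType d)).toFun t).1⁻¹ w = Real.exp (-t) := by
      rw [standardRay_toFun, hermQuad_flatCurve_inv, hw, inv_mulVec_single,
        Finset.sum_eq_single 0 (fun i _ hi => by simp [Pi.single_eq_of_ne hi]) (by simp),
        flagType_zero]
      simp
    have e2 : hermQuad ((standardRay g (flagType d)).toFun t).1 u = Real.exp (-t) := by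
      rw [standardRay_toFun, hermQuad_flatCurve, hu, conjTranspose_mulVec_single,
        Finset.sum_eq_single (Fin.rev 0) (fun i _ hi => by simp [Pi.single_eq_of_ne hi]) (by simp),
        flagType_last]
      simp
      ring_nf
    rw [e1, e2, Real.log_exp] at h1
    linarith
  · filter_upwards [Filter.eventually_ge_atTop 0, tm'.eventually_gt_atTop 0] with t ht hm
    have h1 := (hle t ht).trans (sqrt_le_add_div hm hM le_rfl)
    linarith

end BusemannLimit

/-! ### Frames adapted to a flag -/

section Frames

variable {d : ℕ} {𝕜 : Type*} [RCLike 𝕜] [d.AtLeastTwo]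

/-- Two orthogonal vectors are, up to scaling, the first column of some `k ∈ SL(d,𝕜)` and the
last column of `(k⁻¹)†`: a line–hyperplane flag has an adapted frame. -/
theorem exists_frame {u w : Fin d → 𝕜} (hu : u ≠ 0) (hw : w ≠ 0)
    (huw : Star.star u ⬝ᵥ w = 0) :
    ∃ (k : Matrix.SpecialLinearGroup (Fin d) 𝕜) (l m : 𝕜), l ≠ 0 ∧ m ≠ 0 ∧
      k.1 *ᵥ Pi.single 0 1 = l • w ∧ (k.1⁻¹)ᴴ *ᵥ Pi.single (Fin.rev 0) 1 = m • u := by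
  classical
  set w' : EuclideanSpace 𝕜 (Fin d) := WithLp.toLp 2 w with hw'
  set u' : EuclideanSpace 𝕜 (Fin d) := WithLp.toLp 2 u with hu'
  have hw0 : w' ≠ 0 := fun h => hw (congrArg WithLp.ofLp h)
  have hu0 : u' ≠ 0 := fun h => hu (congrArg WithLp.ofLp h)
  have hinner : inner 𝕜 u' w' = 0 := by
    rw [EuclideanSpace.inner_eq_star_dotProduct, dotProduct_comm]
    exact huw
  set v : Fin d → EuclideanSpace 𝕜 (Fin d) := fun i =>
    if i = 0 then ((‖w'‖⁻¹ : ℝ) : 𝕜) • w' else ((‖u'‖⁻¹ : ℝ) : 𝕜) • u' with hv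
  have hnorm : ∀ z : EuclideanSpace 𝕜 (Fin d), z ≠ 0 → ‖((‖z‖⁻¹ : ℝ) : 𝕜) • z‖ = 1 := by
    intro z hz
    have : ‖z‖ ≠ 0 := norm_ne_zero_iff.2 hz
    rw [norm_smul, RCLike.norm_ofReal, abs_of_nonneg (by positivity), inv_mul_cancel₀ this]
  have hort : Orthonormal 𝕜 (({0, Fin.rev 0} : Set (Fin d)).domRestrict v) := by
    constructor
    · rintro ⟨i, hi⟩
      simp only [Set.domRestrict_apply, hv]
      split_ifs
      · exact hnorm _ hw0
      · exact hnorm _ hu0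
    · rintro ⟨i, hi⟩ ⟨j, hj⟩ hij
      have hij' : i ≠ j := fun h => hij (Subtype.ext h)
      simp only [Set.domRestrict_apply, hv]
      rcases hi with rfl | rfl <;> rcases hj with rfl | rfl
      · exact absurd rfl hij'
      · rw [if_pos rfl, if_neg rev_zero_ne_zero, inner_smul_left, inner_smul_right,
          inner_eq_zero_symm.1 hinner, mul_zero, mul_zero]
      · rw [if_pos rfl, if_neg rev_zero_ne_zero, inner_smul_left, inner_smul_right,
          hinner, mul_zero, mul_zero]
      · exact absurd rfl hij'
  obtain ⟨b, hb⟩ := hort.exists_orthonormalBasis_extension_of_card_eq (by simp)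
  set U : Matrix (Fin d) (Fin d) 𝕜 := Matrix.of fun i j => b j i with hU
  have hUU : Uᴴ * U = 1 := by
    ext i j
    have h1 := orthonormal_iff_ite.1 b.orthonormal i j
    rw [EuclideanSpace.inner_eq_star_dotProduct, dotProduct_comm] at h1
    rw [Matrix.one_apply, ← h1]
    rfl
  have hUU' : U * Uᴴ = 1 := mul_eq_one_comm.1 hUU
  have hdU : U.det ≠ 0 := by
    intro h0
    have := congrArg Matrix.det hUU'
    rw [Matrix.det_mul, h0, zero_mul, Matrix.det_one] at this
    exact zero_ne_one this
  set c : Fin d → 𝕜 := Function.update 1 0 (U.det)⁻¹ with hc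
  have hc0 : ∀ i, c i ≠ 0 := by
    intro i
    by_cases hi : i = 0
    · subst hi; simpa [hc] using hdU
    · simp [hc, Function.update_of_ne hi]
  have hcdet : ∏ i, c i = (U.det)⁻¹ := by
    rw [hc, Finset.prod_update_of_mem (Finset.mem_univ _)]; simp
  have hcol : ∀ (M : Matrix (Fin d) (Fin d) 𝕜) (e : Fin d → 𝕜) (i : Fin d),
      (M * Matrix.diagonal e) *ᵥ Pi.single i 1 = e i • M.col i := by
    intro M e i
    ext j
    simp [Matrix.mulVec_single, Matrix.mul_diagonal, mul_comm]
  have hinv : (U * Matrix.diagonal c)⁻¹ = Matrix.diagonal (fun i => (c i)⁻¹) * Uᴴ := by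
    refine Matrix.inv_eq_left_inv ?_
    calc _ = Matrix.diagonal (fun i => (c i)⁻¹) * (Uᴴ * U) * Matrix.diagonal c := by
          simp only [Matrix.mul_assoc]
      _ = 1 := by
          rw [hUU, Matrix.mul_one, Matrix.diagonal_mul_diagonal, ← Matrix.diagonal_one]
          congr 1; funext i; exact inv_mul_cancel₀ (hc0 i)
  refine ⟨⟨U * Matrix.diagonal c, by
    rw [Matrix.det_mul, Matrix.det_diagonal, hcdet, mul_inv_cancel₀ hdU]⟩,
    c 0 * ((‖w'‖⁻¹ : ℝ) : 𝕜), ((‖u'‖⁻¹ : ℝ) : 𝕜), ?_, ?_, ?_, ?_⟩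
  · exact mul_ne_zero (hc0 0) (by simpa using hw0)
  · simpa using hu0
  · rw [hcol, mul_smul]
    congr 1
    have h1 := congrArg WithLp.ofLp (hb 0 (by simp))
    rw [hv] at h1
    simp only [if_true] at h1
    exact h1
  · rw [hinv, Matrix.conjTranspose_mul, Matrix.conjTranspose_conjTranspose,
      Matrix.diagonal_conjTranspose, hcol]
    have hcl : c (Fin.rev 0) = 1 := by
      simp [hc, Function.update_of_ne rev_zero_ne_zero]
    have h1 := congrArg WithLp.ofLp (hb (Fin.rev 0) (by simp))
    simp only [hv, if_neg (rev_zero_ne_zero (d := d))] at h1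
    simp only [Pi.star_apply, hcl, inv_one, star_one, one_smul]
    exact h1

/-- The standard flag carried along by `k`. -/
noncomputable def frameFlag (k : Matrix.SpecialLinearGroup (Fin d) 𝕜) :
    LineHyperplaneFlag d 𝕜 where
  line := Projectivization.mk 𝕜 (k.1 *ᵥ Pi.single 0 1) (mulVec_single_ne_zero (isUnit_det k) 0)
  hyperplane := Submodule.map k.1.mulVecLin
    (LinearMap.ker (LinearMap.proj (R := 𝕜) (φ := fun _ : Fin d => 𝕜) (Fin.rev 0)))
  isCoatom := by
    have h1 : IsCoatom (LinearMap.ker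
        (LinearMap.proj (R := 𝕜) (φ := fun _ : Fin d => 𝕜) (Fin.rev 0))) :=
      LinearMap.isCoatom_ker_of_surjective fun z => ⟨fun _ => z, rfl⟩
    exact ((Submodule.orderIsoMapComap (Matrix.SpecialLinearGroup.toLin' k)).isCoatom_iff _).2 h1
  line_le := by
    rw [Projectivization.submodule_mk, Submodule.span_singleton_le_iff_mem]
    exact ⟨Pi.single 0 1, by simp [rev_zero_ne_zero], rfl⟩

theorem endpoint_mem_flagManifold (k : Matrix.SpecialLinearGroup (Fin d) 𝕜) :
    (standardRay k (flagType d)).endpoint ∈ flagManifold d 𝕜 :=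
  ⟨frameFlag k, k, Projectivization.submodule_mk _ _, rfl, rfl⟩

end Frames

/-! ### Stars in the visual boundary -/

section Stars

variable {d : ℕ} {𝕜 : Type*} [RCLike 𝕜]

theorem star_dotProduct_frame (g : Matrix.SpecialLinearGroup (Fin d) 𝕜) (u w : Fin d → 𝕜) :
    Star.star (g.1ᴴ *ᵥ u) ⬝ᵥ (g.1⁻¹ *ᵥ w) = Star.star u ⬝ᵥ w := by
  rw [Matrix.star_mulVec, Matrix.conjTranspose_conjTranspose, ← Matrix.dotProduct_mulVec,
    Matrix.mulVec_mulVec, Matrix.mul_nonsing_inv _ (isUnit_det g), Matrix.one_mulVec]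

theorem frame_dual_ne_zero (k : Matrix.SpecialLinearGroup (Fin d) 𝕜) (i : Fin d) :
    (k.1⁻¹)ᴴ *ᵥ Pi.single i (1 : 𝕜) ≠ 0 := by
  refine mulVec_single_ne_zero ?_ i
  rw [← inv_conjTranspose_eq]
  exact Matrix.isUnit_nonsing_inv_det _ (isUnit_det_conjTranspose k)

variable [d.AtLeastTwo]

theorem val_one_eq : (1 : Fin d).val = 1 := by
  have h2 : 2 ≤ d := Nat.AtLeastTwo.prop
  rw [Fin.coe_ofNat_eq_mod, Nat.mod_eq_of_lt (by omega)]

theorem one_le_of_ne_zero {i : Fin d} (hi : i ≠ 0) : 1 ≤ i := by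
  have h1 : i.val ≠ 0 := fun h => hi (Fin.ext h)
  rw [Fin.le_def, val_one_eq]
  omega

/-- If the type of the second ray is off the first wall, the line spanned by the first column of
the frame is determined by the endpoint. -/
theorem span_eq_of_asymptotic {g h : Matrix.SpecialLinearGroup (Fin d) 𝕜}
    {A B : ModelChamber d} (hs : Asymptotic (standardRay g A) (standardRay h B))
    (hB : ∀ i, i ≠ 0 → B.1 i < B.1 0) :
    Submodule.span 𝕜 {g.1 *ᵥ Pi.single 0 (1 : 𝕜)} =
      Submodule.span 𝕜 {h.1 *ᵥ Pi.single 0 (1 : 𝕜)} := by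
  have hs' : Asymptotic (standardRay h B) (standardRay g A) := (asymptoticSetoid d 𝕜).symm hs
  set v := h.1⁻¹ *ᵥ (g.1 *ᵥ Pi.single 0 (1 : 𝕜)) with hv
  have h0 : ∀ i, i ≠ 0 → v i = 0 := by
    intro i hi
    by_contra hne
    have h1 := fst_le_of_asymptotic hs' hne
    rw [fst_eq_of_asymptotic hs] at h1
    exact absurd (hB i hi) (not_lt.2 h1)
  have hv0 : v 0 ≠ 0 := by
    obtain ⟨i, hi⟩ := mulVec_ne_zero (isUnit_det_inv h) (mulVec_single_ne_zero (isUnit_det g) 0)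
    by_cases h1 : i = 0
    · rwa [h1] at hi
    · exact absurd (h0 i h1) hi
  have hve : v = v 0 • Pi.single 0 1 := by
    ext i
    by_cases hi : i = 0
    · subst hi; simp
    · simp [h0 i hi, Pi.single_eq_of_ne hi]
  have hge : g.1 *ᵥ Pi.single 0 (1 : 𝕜) = v 0 • (h.1 *ᵥ Pi.single 0 1) := by
    rw [← Matrix.mulVec_smul, ← hve, hv, Matrix.mulVec_mulVec,
      Matrix.mul_nonsing_inv _ (isUnit_det h), Matrix.one_mulVec]
  rw [hge, Submodule.span_singleton_smul_eq hv0.isUnit]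

theorem lineType_lt {i : Fin d} (hi : i ≠ 0) : (lineType d).1 i < (lineType d).1 0 := by
  have hd : (2 : ℝ) ≤ d := by exact_mod_cast Nat.AtLeastTwo.prop (n := d)
  have h0 : (0 : ℝ) < 2 * d * (d - 1) := by nlinarith
  simp only [lineType, if_neg hi, if_true]
  exact div_lt_div_of_pos_right (by linarith) (Real.sqrt_pos.2 h0)

theorem flagType_lt {i : Fin d} (hi : i ≠ 0) : (flagType d).1 i < (flagType d).1 0 := by
  rw [flagType_zero]
  by_cases h : i = Fin.rev 0
  · rw [h, flagType_last]; norm_num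
  · rw [flagType_of_ne hi h]; norm_num

/-- The star of `τ` consists of the endpoints of the rays whose frame has `τ` as its line: a Weyl
chamber contains a single point of line type. -/
theorem mem_star_iff {τ : ℙ 𝕜 (Fin d → 𝕜)} {ξ : VisualBoundary d 𝕜} :
    ξ ∈ SymSpace.star τ ↔ ∃ (h : Matrix.SpecialLinearGroup (Fin d) 𝕜) (B : ModelChamber d),
      τ.submodule = Submodule.span 𝕜 {h.1 *ᵥ Pi.single 0 1} ∧
        ξ = (standardRay h B).endpoint := by
  constructor
  · rintro ⟨h, ⟨ζ, ⟨A, hA⟩, k, hk, hζ⟩, B, hB⟩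
    refine ⟨h, B, ?_, hB⟩
    rw [hk, span_eq_of_asymptotic (asymptotic_of_endpoint_eq (hA.symm.trans hζ))
      fun i hi => lineType_lt hi]
  · rintro ⟨h, B, hτ, hξ⟩
    exact ⟨h, ⟨_, ⟨lineType d, rfl⟩, h, hτ, rfl⟩, B, hξ⟩

end Stars

/-! ### Busemann differences along a geodesic -/

section FlatComputation

variable {d : ℕ} {𝕜 : Type*} [RCLike 𝕜] [d.AtLeastTwo]
  {g : Matrix.SpecialLinearGroup (Fin d) 𝕜} {a : Fin d → ℝ} {ha : ∑ i, a i = 0}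

theorem log_hermQuad_inv_flatCurve {w : Fin d → 𝕜} (hw : w ≠ 0)
    (hsupp : ∀ i, (g.1⁻¹ *ᵥ w) i ≠ 0 → a i = a 0) (s : ℝ) :
    Real.log (hermQuad (flatCurve g a ha s).1⁻¹ w) =
      Real.log (hermQuad (flatCurve g a ha 0).1⁻¹ w) - 2 * a 0 * s := by
  have h1 : hermQuad (flatCurve g a ha s).1⁻¹ w =
      Real.exp (-(2 * a 0 * s)) * hermQuad (flatCurve g a ha 0).1⁻¹ w := by
    rw [hermQuad_flatCurve_inv, hermQuad_flatCurve_inv, Finset.mul_sum]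
    refine Finset.sum_congr rfl fun i _ => ?_
    by_cases hi : (g.1⁻¹ *ᵥ w) i = 0
    · simp [hi]
    · rw [hsupp i hi]; simp
  rw [h1, Real.log_mul (Real.exp_pos _).ne' (hermQuad_pos (flatCurve g a ha 0).2.1.inv hw).ne',
    Real.log_exp]
  ring

theorem log_hermQuad_flatCurve_le {u : Fin d → 𝕜} (hu : u ≠ 0)
    (hsupp : ∀ i, (g.1ᴴ *ᵥ u) i ≠ 0 → a i ≤ a 1) {s : ℝ} (hs : 0 ≤ s) :
    Real.log (hermQuad (flatCurve g a ha s).1 u) ≤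
      Real.log (hermQuad (flatCurve g a ha 0).1 u) + 2 * a 1 * s := by
  have h1 : hermQuad (flatCurve g a ha s).1 u ≤
      Real.exp (2 * a 1 * s) * hermQuad (flatCurve g a ha 0).1 u := by
    rw [hermQuad_flatCurve, hermQuad_flatCurve, Finset.mul_sum]
    refine Finset.sum_le_sum fun i _ => ?_
    by_cases hi : (g.1ᴴ *ᵥ u) i = 0
    · simp [hi]
    · have h2 : Real.exp (2 * a i * s) ≤ Real.exp (2 * a 1 * s) :=
        Real.exp_le_exp.2 (mul_le_mul_of_nonneg_right (by linarith [hsupp i hi]) hs)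
      simpa using mul_le_mul_of_nonneg_right h2 (sq_nonneg ‖(g.1ᴴ *ᵥ u) i‖)
  have h0 := hermQuad_pos (flatCurve g a ha 0).2.1 hu
  refine (Real.log_le_log (hermQuad_pos (flatCurve g a ha s).2.1 hu) h1).trans ?_
  rw [Real.log_mul (Real.exp_pos _).ne' h0.ne', Real.log_exp, add_comm]

theorem log_hermQuad_flatCurve {u : Fin d → 𝕜} (hu : u ≠ 0)
    (hsupp : ∀ i, (g.1ᴴ *ᵥ u) i ≠ 0 → a i = a 1) (s : ℝ) :
    Real.log (hermQuad (flatCurve g a ha s).1 u) =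
      Real.log (hermQuad (flatCurve g a ha 0).1 u) + 2 * a 1 * s := by
  have h1 : hermQuad (flatCurve g a ha s).1 u =
      Real.exp (2 * a 1 * s) * hermQuad (flatCurve g a ha 0).1 u := by
    rw [hermQuad_flatCurve, hermQuad_flatCurve, Finset.mul_sum]
    refine Finset.sum_congr rfl fun i _ => ?_
    by_cases hi : (g.1ᴴ *ᵥ u) i = 0
    · simp [hi]
    · rw [hsupp i hi]; simp
  rw [h1, Real.log_mul (Real.exp_pos _).ne' (hermQuad_pos (flatCurve g a ha 0).2.1 hu).ne',
    Real.log_exp, add_comm]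

/-- Off the wall `a₁ = a₂` the line is the first coordinate axis of the frame, so a form that
vanishes on it has no first coordinate. -/
theorem le_snd_of_orthogonal (hanti : Antitone a) {u w : Fin d → 𝕜} (hw : w ≠ 0)
    (huw : Star.star u ⬝ᵥ w = 0) (hsupp : ∀ i, (g.1⁻¹ *ᵥ w) i ≠ 0 → a i = a 0) (i : Fin d)
    (hi : (g.1ᴴ *ᵥ u) i ≠ 0) : a i ≤ a 1 := by
  by_cases hi0 : i = 0
  · subst hi0
    by_contra! hlt
    have h0 : ∀ j, j ≠ 0 → (g.1⁻¹ *ᵥ w) j = 0 := by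
      intro j hj
      by_contra hne
      have h1 := hsupp j hne
      have h2 := hanti (one_le_of_ne_zero hj)
      linarith
    obtain ⟨j, hj⟩ := mulVec_ne_zero (isUnit_det_inv g) hw
    have hj0 : j = 0 := by
      by_contra h1; exact hj (h0 j h1)
    rw [hj0] at hj
    rw [← star_dotProduct_frame g, dotProduct,
      Finset.sum_eq_single 0 (fun k _ hk => by rw [h0 k hk, mul_zero]) (by simp)] at huw
    rcases mul_eq_zero.1 huw with h1 | h1
    · exact hi (star_eq_zero.1 h1)
    · exact hj h1
  · exact hanti (one_le_of_ne_zero hi0)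

/-- With `v` the coordinates of `w` in the frame, the form with coordinates `(v₂, -v₁, 0, …)`
kills `w`. Off the wall `a₁ = a₂` it is a multiple of the second coordinate. If `v₁ = v₂ = 0`,
then `a` is constant up to some index `≥ 3`, and the first coordinate form serves. -/
theorem exists_orthogonal_of_support (hanti : Antitone a) {w : Fin d → 𝕜} (hw : w ≠ 0)
    (hsupp : ∀ i, (g.1⁻¹ *ᵥ w) i ≠ 0 → a i = a 0) :
    ∃ u : Fin d → 𝕜, u ≠ 0 ∧ Star.star u ⬝ᵥ w = 0 ∧
      ∀ i, (g.1ᴴ *ᵥ u) i ≠ 0 → a i = a 1 := by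
  set v := g.1⁻¹ *ᵥ w with hv
  have h10 : (1 : Fin d) ≠ 0 := by
    intro h
    have h1 := congrArg Fin.val h
    rw [val_one_eq] at h1
    simp at h1
  -- It suffices to find the coordinates `f` of `u` in the dual frame.
  suffices H : ∃ f : Fin d → 𝕜, f ≠ 0 ∧ Star.star f ⬝ᵥ v = 0 ∧ ∀ i, f i ≠ 0 → a i = a 1 by
    obtain ⟨f, hf, hfv, hfs⟩ := H
    have hu : g.1ᴴ *ᵥ ((g.1ᴴ)⁻¹ *ᵥ f) = f := by
      rw [Matrix.mulVec_mulVec, Matrix.mul_nonsing_inv _ (isUnit_det_conjTranspose g),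
        Matrix.one_mulVec]
    refine ⟨(g.1ᴴ)⁻¹ *ᵥ f, ?_, ?_, ?_⟩
    · intro h0
      rw [h0, Matrix.mulVec_zero] at hu
      exact hf hu.symm
    · rw [← star_dotProduct_frame g, hu, hfv]
    · rwa [hu]
  by_cases h : v 0 = 0 ∧ v 1 = 0
  · obtain ⟨i, hi⟩ := mulVec_ne_zero (isUnit_det_inv g) hw
    have hi0 : i ≠ 0 := by rintro rfl; exact hi h.1
    have h1 := hsupp i hi
    have h2 := hanti (one_le_of_ne_zero hi0)
    have h3 := hanti (Fin.zero_le 1)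
    refine ⟨Pi.single 0 1, by simp, ?_, fun j hj => ?_⟩
    · rw [← Pi.single_star, single_dotProduct, h.1, mul_zero]
    · have : j = 0 := by
        by_contra hne; exact hj (Pi.single_eq_of_ne hne _)
      rw [this]; linarith
  · refine ⟨Pi.single 0 (Star.star (v 1)) - Pi.single 1 (Star.star (v 0)), ?_, ?_, fun j hj => ?_⟩
    · intro h0
      refine h ⟨?_, ?_⟩
      · have := congrFun h0 1
        simpa [h10] using this
      · have := congrFun h0 0
        simpa [h10.symm] using this
    · rw [star_sub, ← Pi.single_star, ← Pi.single_star, star_star, star_star, sub_dotProduct,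
        single_dotProduct, single_dotProduct]
      ring
    · by_cases hj1 : j = 1
      · rw [hj1]
      · by_cases hj0 : j = 0
        · subst hj0
          have h1 : v 1 ≠ 0 := by
            intro h1; apply hj; simp [h1, h10.symm]
          exact (hsupp 1 h1).symm
        · exact absurd (by simp [Pi.single_eq_of_ne hj0, Pi.single_eq_of_ne hj1]) hj

end FlatComputation

/-! ### The minimum over the flags in a star -/

section Minimum

variable {d : ℕ} {𝕜 : Type*} [RCLike 𝕜] [d.AtLeastTwo]

theorem rootDist_flatCurve (g : Matrix.SpecialLinearGroup (Fin d) 𝕜) (A : ModelChamber d) {s : ℝ}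
    (hs : 0 ≤ s) : rootDist (flatCurve g A.1 A.2.2.1 0) (flatCurve g A.1 A.2.2.1 s) =
      s * A.1 0 - s * A.1 1 := by
  have h : IsVectorDist (flatCurve g A.1 A.2.2.1 0) (flatCurve g A.1 A.2.2.1 s)
      (fun i => s * A.1 i) :=
    ⟨fun i j hij => mul_le_mul_of_nonneg_left (A.2.1 hij) hs,
      by rw [← Finset.mul_sum, A.2.2.1, mul_zero], g,
      Subtype.ext (by rw [flatCurve_val, smul_base_val]; simp), rfl⟩
  rw [rootDist, (vectorDist_spec _ _).unique h]

/-- If two rays are asymptotic, the line of the second frame is supported, in the coordinates of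
the first, where the exponent of the first ray is maximal. -/
theorem eq_fst_of_mem_span {g h : Matrix.SpecialLinearGroup (Fin d) 𝕜} {A B : ModelChamber d}
    (hs : Asymptotic (standardRay g A) (standardRay h B)) {w : Fin d → 𝕜}
    (hw : w ∈ Submodule.span 𝕜 {h.1 *ᵥ Pi.single 0 (1 : 𝕜)}) (i : Fin d)
    (hi : (g.1⁻¹ *ᵥ w) i ≠ 0) : A.1 i = A.1 0 := by
  obtain ⟨z, rfl⟩ := Submodule.mem_span_singleton.1 hw
  rw [Matrix.mulVec_smul, Pi.smul_apply, smul_eq_mul] at hi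
  refine le_antisymm (A.2.1 (Fin.zero_le i)) ?_
  rw [fst_eq_of_asymptotic hs]
  exact fst_le_of_asymptotic hs (right_ne_zero_of_mul hi)

/-- A ray whose endpoint is a point of the flag manifold in the star of `τ` has flag type, and
its frame line is `τ`. -/
theorem exists_eq_standardRay_flagType {τ : ℙ 𝕜 (Fin d → 𝕜)} {c : GeodesicRay d 𝕜}
    (hF : c.endpoint ∈ flagManifold d 𝕜) (hst : c.endpoint ∈ SymSpace.star τ) :
    ∃ g, c = standardRay g (flagType d) ∧
      τ.submodule = Submodule.span 𝕜 {g.1 *ᵥ Pi.single 0 (1 : 𝕜)} := by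
  obtain ⟨g, A, rfl⟩ := c.exists_eq_standardRay
  obtain ⟨-, k, -, -, hk⟩ := hF
  obtain ⟨h, B, hτ, hB⟩ := mem_star_iff.1 hst
  have h1 := asymptotic_of_endpoint_eq hk
  have hA : A = flagType d := eq_flagType
    ((fst_eq_of_asymptotic h1).trans flagType_zero)
    ((last_eq_of_asymptotic h1).trans flagType_last)
  subst hA
  refine ⟨g, rfl, hτ.trans ?_⟩
  exact span_eq_of_asymptotic (asymptotic_of_endpoint_eq hB.symm) fun i hi => flagType_lt hi

theorem frame_orthogonal (k : Matrix.SpecialLinearGroup (Fin d) 𝕜) :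
    Star.star ((k.1⁻¹)ᴴ *ᵥ Pi.single (Fin.rev 0) (1 : 𝕜)) ⬝ᵥ (k.1 *ᵥ Pi.single 0 1) = 0 := by
  rw [← star_dotProduct_frame k, conjTranspose_mulVec_single, inv_mulVec_single]
  simp [rev_zero_ne_zero]

end Minimum

end SymSpace

theorem mainTheorem4 {𝕜 : Type*} [RCLike 𝕜] {d : ℕ} [d.AtLeastTwo]
    (τ : ℙ 𝕜 (Fin d → 𝕜)) (x y : SymSpace d 𝕜)
    (hy : y ∈ SymSpace.weylCone x (SymSpace.star τ)) :
    IsLeast {r : ℝ | ∃ b : SymSpace d 𝕜 → ℝ,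
        (∃ ξ ∈ SymSpace.flagManifold d 𝕜 ∩ SymSpace.star τ, SymSpace.IsBusemann ξ b) ∧
          r = b x - b y}
      (SymSpace.rootDist x y) := by
  open SymSpace in
  obtain ⟨c, rfl, hc, s, hs, rfl⟩ := hy
  obtain ⟨g, A, rfl⟩ := c.exists_eq_standardRay
  obtain ⟨h, B, hτ, hB⟩ := mem_star_iff.1 hc
  have hasy := asymptotic_of_endpoint_eq hB
  simp only [standardRay_toFun]
  rw [rootDist_flatCurve g A hs]
  constructor
  · -- A flag with line `τ` whose form lives on the first two coordinates attains the minimum.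
    have hw := mulVec_single_ne_zero (isUnit_det h) 0
    obtain ⟨u, hu, huw, husupp⟩ := exists_orthogonal_of_support A.2.1 hw
      (eq_fst_of_mem_span hasy (Submodule.mem_span_singleton_self _))
    obtain ⟨k, l, m, hl, hm, hkw, hku⟩ := exists_frame hu hw huw
    have hspan : Submodule.span 𝕜 {k.1 *ᵥ Pi.single 0 (1 : 𝕜)} =
        Submodule.span 𝕜 {h.1 *ᵥ Pi.single 0 1} := by
      rw [hkw, Submodule.span_singleton_smul_eq hl.isUnit]
    refine ⟨fun p => (Real.log (hermQuad p.1⁻¹ (k.1 *ᵥ Pi.single 0 1)) +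
        Real.log (hermQuad p.1 ((k.1⁻¹)ᴴ *ᵥ Pi.single (Fin.rev 0) 1))) / 2,
      ⟨(standardRay k (flagType d)).endpoint, ⟨endpoint_mem_flagManifold k,
      mem_star_iff.2 ⟨k, flagType d, hτ.trans hspan.symm, rfl⟩⟩,
      standardRay k (flagType d), rfl, 0, fun p => ?_⟩, ?_⟩
    · rw [add_zero]
      exact tendsto_riemDist_sub k p
    · simp only
      rw [log_hermQuad_inv_flatCurve (mulVec_single_ne_zero (isUnit_det k) 0)
        (eq_fst_of_mem_span hasy (hspan ▸ Submodule.mem_span_singleton_self _)) s,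
        log_hermQuad_flatCurve (frame_dual_ne_zero k _) (fun i hi => husupp i ?_) s]
      · ring
      · rw [hku, Matrix.mulVec_smul, Pi.smul_apply, smul_eq_mul] at hi
        exact right_ne_zero_of_mul hi
  · rintro r ⟨b, ⟨ξ, ⟨hF, hst⟩, c, rfl, C, hb⟩, rfl⟩
    obtain ⟨k, rfl, hk⟩ := exists_eq_standardRay_flagType hF hst
    -- The limit is unique, so `b` is the explicit function of the flag up to a constant.
    have hval := fun p => tendsto_nhds_unique (hb p) (tendsto_riemDist_sub k p)
    have hx := hval (flatCurve g A.1 A.2.2.1 0)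
    have hy := hval (flatCurve g A.1 A.2.2.1 s)
    have hw := mulVec_single_ne_zero (isUnit_det k) 0
    have hsupp := eq_fst_of_mem_span hasy (w := k.1 *ᵥ Pi.single 0 1)
      (hτ ▸ hk ▸ Submodule.mem_span_singleton_self _)
    rw [log_hermQuad_inv_flatCurve hw hsupp s] at hy
    have hle := log_hermQuad_flatCurve_le (ha := A.2.2.1) (frame_dual_ne_zero k (Fin.rev 0))
      (le_snd_of_orthogonal A.2.1 hw (frame_orthogonal k) hsupp) hs
    linarith
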